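/- Let $d\ge 0$ be an integer and let $X=(X_t)_{t\in\mathbb Z}$ be a stationary and ergodic process with values in $\mathbb R^d$, defined on a probability space $(\Omega,\mathcal A,\mathbb P)$. Let $F:\mathbb R\to(0,1]$ be a cumulative distribution function that is Lipschitz and positive everywhere, let $(a_j)_{j\ge 1}$ be a sequence of real numbers with $\sum_{j\ge 1} j|a_j|<\infty$, and let $\gamma\in\mathbb R^d$. Consider the model, for a process $Y=(Y_t)_{t\in\mathbb Z}$ with values in $\{0,1\}$, $$\mathbb P\bigl(Y_t=1\mid Y_{t-1},Y_{t-2},\ldots,\,X\bigr)=F(\mu_t)\ \text{ a.s.},\qquad \mu_t=\sum_{j=1}^{\infty}a_jY_{t-j}+\gamma'X_t,\qquad t\in\mathbb Z,\tag{1}$$ where the conditioning is on the past of $Y$ and on the whole covariate process $X=(X_s)_{s\in\mathbb Z}$. Then there exists a unique stationary process $(Y_t)_{t\in\mathbb Z}$ satisfying (1), and the bivariate process $((Y_t,X_t))_{t\in\mathbb Z}$ is stationary and ergodic. Precisely: (Existence.) There is a probability measure $\mathbb Q$ on $\{0,1\}^{\mathbb Z}\times\Omega$ whose marginal on $\Omega$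 is $\mathbb P$ such that the processes $Y_t(y,\omega)=y_t$ and $(y,\omega)\mapsto X_t(\omega)$ satisfy (1) under $\mathbb Q$; the process $(Y_t)_{t\in\mathbb Z}$ is stationary, and $((Y_t,X_t))_{t\in\mathbb Z}$ is stationary and ergodic under $\mathbb Q$. (Uniqueness.) If $Y'$ and $X'$ are processes on any probability space such that $X'$ has the same law as $X$ and (1) holds for $(Y',X')$, then $((Y'_t,X'_t))_{t\in\mathbb Z}$ has the same law as $((Y_t,X_t))_{t\in\mathbb Z}$ under $\mathbb Q$. -/

import Mathlib

open MeasureTheory ProbabilityTheory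

noncomputable section

/-- The left shift on two-sided sequences: `(z_t)_{t ∈ ℤ} ↦ (z_{t+1})_{t ∈ ℤ}`. -/
def seqShift {S : Type*} (z : ℤ → S) : ℤ → S := fun t => z (t + 1)

/-- The law, on the product space `S^ℤ`, of a process `(Z_t)_{t ∈ ℤ}` with state space `S`. -/
def pathLaw {Ω S : Type*} [MeasurableSpace Ω] [MeasurableSpace S]
    (P : Measure Ω) (Z : ℤ → Ω → S) : Measure (ℤ → S) :=
  P.map (fun ω t => Z t ω)

/-- `(Z_t)_{t ∈ ℤ}` is a (strictly) stationary process under `P`: its law is invariant under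
the shift. -/
structure IsStationaryProcess {Ω S : Type*} [MeasurableSpace Ω] [MeasurableSpace S]
    (P : Measure Ω) (Z : ℤ → Ω → S) : Prop where
  measurable : ∀ t, Measurable (Z t)
  invariant : MeasurePreserving seqShift (pathLaw P Z) (pathLaw P Z)

/-- `(Z_t)_{t ∈ ℤ}` is a stationary and ergodic process under `P`: its law is invariant under
the shift, and every shift-invariant measurable set of paths is trivial for that law. -/
structure IsStationaryErgodicProcess {Ω S : Type*} [MeasurableSpace Ω] [MeasurableSpace S]
    (P : Measure Ω) (Z : ℤ → Ω → S) : Prop extends IsStationaryProcess P Z where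
  ergodic : Ergodic seqShift (pathLaw P Z)

/-- The σ-algebra generated by `Y_{t-1}, Y_{t-2}, …` and the whole process `X = (X_s)_{s ∈ ℤ}`. -/
abbrev pastSigma {Ω E G : Type*} [MeasurableSpace E] [MeasurableSpace G]
    (Y : ℤ → Ω → E) (X : ℤ → Ω → G) (t : ℤ) : MeasurableSpace Ω :=
  (⨆ j : ℕ+, MeasurableSpace.comap (Y (t - (j : ℤ))) inferInstance) ⊔
    ⨆ s : ℤ, MeasurableSpace.comap (X s) inferInstance

/-- The latent variable `μ_t = ∑_{j ≥ 1} a_j Y_{t-j} + γ' X_t`. -/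
def latent {Ω : Type*} {d : ℕ} (a : ℕ+ → ℝ) (γ : EuclideanSpace ℝ (Fin d))
    (Y : ℤ → Ω → Fin 2) (X : ℤ → Ω → EuclideanSpace ℝ (Fin d)) (t : ℤ) (ω : Ω) : ℝ :=
  (∑' j : ℕ+, a j * ((Y (t - (j : ℤ)) ω : ℕ) : ℝ)) + inner ℝ γ (X t ω)

/-- The processes `Y` (with values in `{0,1}`) and `X` (with values in `ℝ^d`), defined on the same
probability space, satisfy `P(Y_t = 1 | Y_{t-1}, Y_{t-2}, …, X) = F(μ_t)` almost surely, for all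
`t ∈ ℤ`. -/
structure SatisfiesBinaryModel {Ω : Type*} [MeasurableSpace Ω] {d : ℕ} (F : ℝ → ℝ) (a : ℕ+ → ℝ)
    (γ : EuclideanSpace ℝ (Fin d)) (P : Measure Ω)
    (Y : ℤ → Ω → Fin 2) (X : ℤ → Ω → EuclideanSpace ℝ (Fin d)) : Prop where
  measurable_response : ∀ t, Measurable (Y t)
  measurable_covariate : ∀ t, Measurable (X t)
  condProb_eq : ∀ t : ℤ,
    P⟦{ω | Y t ω = 1} | pastSigma Y X t⟧ =ᵐ[P] fun ω => F (latent a γ Y X t ω)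

/-- The bivariate process `((Y_t, X_t))_{t ∈ ℤ}`. -/
def jointProcess {Ω E G : Type*} (Y : ℤ → Ω → E) (X : ℤ → Ω → G) : ℤ → Ω → E × G :=
  fun t ω => (Y t ω, X t ω)

/-- The response process on the enlargement `E^ℤ × Ω` of `Ω`: `Y_t(y, ω) = y_t`. -/
def coordResponse {Ω E : Type*} : ℤ → (ℤ → E) × Ω → E := fun t p => p.1 t

/-- A process `X` on `Ω` seen on the enlargement `E^ℤ × Ω` of `Ω`: `(y, ω) ↦ X_t(ω)`. -/
def liftCovariate {Ω E G : Type*} (X : ℤ → Ω → G) : ℤ → (ℤ → E) × Ω → G := fun t p => X t p.2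

end

open scoped symmDiff

/-! Realise the model by i.i.d. uniform noise `U`, independent of `X`, through the recursion `Y_t =
1` iff `U_t ≤ F(μ_t)`. The point is that this recursion forgets its remote past.

Call `τ` a regeneration time if, at each time `τ + k`, one of two things happens. Either `U` lies
below `F(-∑|a_j| + γ'X)`, which forces a `1` whatever the past. Or `U` is further than `L ∑_{j>k}
|a_j|` from the threshold computed with zero past before `τ`, so that changing that past cannot move
the threshold across `U`. From such a `τ` on, all solutions coincide (`Regenerates.eq_path`). Given
the earlier noise and `X`, the step `k` succeeds with positive probability, as `F > 0`, and with
probability at least `1 - 2L ∑_{j>k} |a_j|`. These defects are summable because `∑ j|a_j| < ∞`, so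
regeneration has positive probability (`measure_regenerates_zero_pos`). The joint shift on noise and
covariate is ergodic (`ergodic_prodMap_seqShift`), hence almost surely there are regeneration times
arbitrarily far in the past (`ae_recurrent`).

Existence: paths started from the zero past at times going to `-∞` then stabilise. Their limit
`limitPath` solves the recursion and commutes with the shift almost surely, so the pair formed with
`X` is a factor of an ergodic system.

Uniqueness: the model fixes the law of the next response given the history, so any solution has the
law of its own past before `s` continued by fresh noise (`map_history_eq_map_path`). As `s → -∞`, a
regeneration time falls between `s` and any given window with probability tending to one. There the
continued path equals `limitPath`, which does not involve the original solution
(`map_zip_eq_map_solution`). -/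

lemma measurable_seqShift {S : Type*} [MeasurableSpace S] :
    Measurable (seqShift : (ℤ → S) → ℤ → S) :=
  measurable_pi_lambda _ fun t => measurable_pi_apply (t + 1)

lemma seqShift_iterate_apply {S : Type*} (m : ℕ) (z : ℤ → S) (t : ℤ) :
    (seqShift^[m] z) t = z (t + m) := by
  induction m generalizing t with
  | zero => simp
  | succ k ih =>
    rw [Function.iterate_succ_apply']
    simp only [seqShift, ih]
    congr 1
    push_cast
    ring

/-! ### I.i.d. noise: resampling a coordinate, independence of distant windows. -/

section Noise

variable {V : Type*} [MeasurableSpace V] (κ : Measure V) [IsProbabilityMeasure κ]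

/-- The law of an i.i.d. sequence indexed by `ℤ` with marginal `κ`. -/
noncomputable abbrev noiseLaw : Measure (ℤ → V) := Measure.infinitePi fun _ => κ

lemma measurePreserving_seqShift_noiseLaw :
    MeasurePreserving seqShift (noiseLaw κ) (noiseLaw κ) :=
  ⟨measurable_seqShift, Measure.map_infinitePi_infinitePi_of_inj (P := fun _ : ℤ => κ)
    (add_left_injective (1 : ℤ))⟩

/-- Replacing one coordinate of an i.i.d. sequence by a fresh copy does not change its law. -/
lemma measurePreserving_update_noiseLaw (k : ℤ) :
    MeasurePreserving (fun p : (ℤ → V) × V => Function.update p.1 k p.2)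
      ((noiseLaw κ).prod κ) (noiseLaw κ) := by
  have hm : Measurable fun p : (ℤ → V) × V => Function.update p.1 k p.2 := by
    refine measurable_pi_lambda _ fun i => ?_
    by_cases h : i = k
    · subst h; simpa using measurable_snd
    · simpa [Function.update_of_ne h, Function.comp_def] using
        (measurable_pi_apply i).comp (measurable_fst (α := ℤ → V) (β := V))
  refine ⟨hm, Measure.eq_infinitePi _ fun s t ht => ?_⟩
  rw [Measure.map_apply hm (MeasurableSet.pi s.countable_toSet fun i _ => ht i)]
  by_cases hk : k ∈ s
  · have : (fun p : (ℤ → V) × V => Function.update p.1 k p.2) ⁻¹' (Set.pi s t) =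
        (Set.pi (s.erase k) t) ×ˢ (t k) := by
      ext p
      simp only [Set.mem_preimage, Set.mem_pi, Finset.mem_coe, Set.mem_prod, Finset.mem_erase]
      constructor
      · intro h
        refine ⟨fun i hi => by simpa [Function.update_of_ne hi.1] using h i hi.2, ?_⟩
        simpa using h k hk
      · rintro ⟨h1, h2⟩ i hi
        by_cases hik : i = k
        · subst hik; simpa using h2
        · simpa [Function.update_of_ne hik] using h1 i ⟨hik, hi⟩
    rw [this, Measure.prod_prod, Measure.infinitePi_pi _ (fun i _ => ht i),
      Finset.prod_erase_mul s (fun i => κ (t i)) hk]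
  · have : (fun p : (ℤ → V) × V => Function.update p.1 k p.2) ⁻¹' (Set.pi s t) =
        (Set.pi s t) ×ˢ Set.univ := by
      ext p
      simp only [Set.mem_preimage, Set.mem_pi, Finset.mem_coe, Set.mem_prod, Set.mem_univ, and_true]
      refine forall₂_congr fun i hi => ?_
      have hik : i ≠ k := fun h => hk (h ▸ hi)
      simp [Function.update_of_ne hik]
    rw [this, Measure.prod_prod, Measure.infinitePi_pi _ (fun i _ => ht i)]
    simp

/-- Sets of i.i.d. sequences that look at a finite window before and after a long shift are
independent. -/
lemma noiseLaw_inter_preimage_iterate (J : Finset ℤ) (m : ℕ)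
    (hJ : ∀ i ∈ J, i + m ∉ J) {C D : Set (J → V)} (hC : MeasurableSet C) (hD : MeasurableSet D) :
    noiseLaw κ ({u | J.restrict (π := fun _ => V) u ∈ C} ∩
        {u | J.restrict (π := fun _ => V) (seqShift^[m] u) ∈ D}) =
      noiseLaw κ {u | J.restrict (π := fun _ => V) u ∈ C} *
        noiseLaw κ {u | J.restrict (π := fun _ => V) (seqShift^[m] u) ∈ D} := by
  have hind : iIndepFun (fun (i : ℤ) (u : ℤ → V) => u i) (noiseLaw κ) :=
    iIndepFun_infinitePi (X := fun _ v => v) fun _ => measurable_id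
  have hdisj : Disjoint J (J.image (· + (m : ℤ))) := by
    rw [Finset.disjoint_left]
    intro i hi hi'
    obtain ⟨j, hj, rfl⟩ := Finset.mem_image.1 hi'
    exact hJ j hj hi
  have h := hind.indepFun_finset J (J.image (· + (m : ℤ))) hdisj fun i => measurable_pi_apply i
  let φ : ((J.image (· + (m : ℤ)) : Finset ℤ) → V) → (J → V) := fun w i =>
    w ⟨i + m, Finset.mem_image_of_mem _ i.2⟩
  have hφ : Measurable φ := measurable_pi_lambda _ fun i => measurable_pi_apply _
  have h2 := (h.comp measurable_id hφ).measure_inter_preimage_eq_mul C D hC hD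
  have e1 : (id ∘ fun (a : ℤ → V) (i : J) => a i) ⁻¹' C =
      {u | J.restrict (π := fun _ => V) u ∈ C} := rfl
  have e2 : (φ ∘ fun (a : ℤ → V) (i : (J.image (· + (m : ℤ)) : Finset ℤ)) => a i) ⁻¹' D =
      {u | J.restrict (π := fun _ => V) (seqShift^[m] u) ∈ D} := by
    ext u
    have : J.restrict (π := fun _ => V) (seqShift^[m] u) = φ fun i => u i := by
      ext i
      simp [φ, seqShift_iterate_apply]
    simp [this]
  rwa [e1, e2] at h2

end Noise

/-! ### Ergodicity of an i.i.d. shift times an ergodic system. -/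

section Ergodicity

variable {V S : Type*} [MeasurableSpace V] [MeasurableSpace S]

/-- The sets in a product of a sequence space and `S` that involve finitely many coordinates of
the sequence. -/
def windowSets (V S : Type*) [MeasurableSpace V] [MeasurableSpace S] : Set (Set ((ℤ → V) × S)) :=
  {A | ∃ J : Finset ℤ, ∃ B : Set ((J → V) × S), MeasurableSet B ∧
    A = (fun z => (J.restrict z.1, z.2)) ⁻¹' B}

lemma measurable_window (J : Finset ℤ) :
    Measurable fun z : (ℤ → V) × S => (J.restrict z.1, z.2) :=
  ((Finset.measurable_restrict J).comp measurable_fst).prodMk measurable_snd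

/-- An algebra generating the product σ-algebra is dense in measure; this is what allows an
invariant set to be approximated by one seeing only finitely many noise coordinates. -/
lemma isSetAlgebra_windowSets : IsSetAlgebra (windowSets V S) where
  empty_mem := ⟨∅, ∅, MeasurableSet.empty, by simp⟩
  compl_mem := by
    rintro _ ⟨J, B, hB, rfl⟩
    exact ⟨J, Bᶜ, hB.compl, rfl⟩
  union_mem := by
    rintro _ _ ⟨J, B, hB, rfl⟩ ⟨J', B', hB', rfl⟩
    refine ⟨J ∪ J',
      (fun z => (Finset.restrict₂ (π := fun _ => V) (Finset.subset_union_left (s₂ := J')) z.1,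
        z.2)) ⁻¹' B ∪
      (fun z => (Finset.restrict₂ (π := fun _ => V) (Finset.subset_union_right (s₁ := J)) z.1,
        z.2)) ⁻¹' B', ?_, rfl⟩
    have hr : ∀ {I I' : Finset ℤ} (h : I ⊆ I'), Measurable fun z : (I' → V) × S =>
        (Finset.restrict₂ (π := fun _ => V) h z.1, z.2) := fun h =>
      ((Finset.measurable_restrict₂ (X := fun _ => V) h).comp measurable_fst).prodMk measurable_snd
    exact ((hr _) hB).union ((hr _) hB')

lemma generateFrom_windowSets :
    (inferInstance : MeasurableSpace ((ℤ → V) × S)) =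
      MeasurableSpace.generateFrom (windowSets V S) := by
  apply le_antisymm
  · have key : @Measurable _ _ (MeasurableSpace.generateFrom (windowSets V S)) inferInstance
        (id : (ℤ → V) × S → (ℤ → V) × S) := by
      refine @Measurable.prodMk _ _ _ _ _ (_) _ _ ?_ ?_
      · refine @measurable_pi_lambda _ _ _ (_) _ _ fun i => ?_
        intro s hs
        refine MeasurableSpace.measurableSet_generateFrom
          ⟨{i}, {w | w.1 ⟨i, by simp⟩ ∈ s}, ?_, rfl⟩
        exact ((measurable_pi_apply _).comp measurable_fst) hs
      · intro s hs
        exact MeasurableSpace.measurableSet_generateFrom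
          ⟨∅, {w | w.2 ∈ s}, measurable_snd hs, rfl⟩
    intro s hs
    exact key hs
  · refine MeasurableSpace.generateFrom_le ?_
    rintro _ ⟨J, B, hB, rfl⟩
    exact measurable_window J hB

variable (κ : Measure V) [IsProbabilityMeasure κ] {ν : Measure S} [IsProbabilityMeasure ν]

/-- The product of an i.i.d. shift with an ergodic system is ergodic. -/
theorem ergodic_prodMap_seqShift {σ : S → S} (hσ : Ergodic σ ν) :
    Ergodic (Prod.map seqShift σ) ((noiseLaw κ).prod ν) := by
  set η := noiseLaw κ
  set μ := η.prod ν
  have hs := measurePreserving_seqShift_noiseLaw κ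
  have hT : MeasurePreserving (Prod.map seqShift σ) μ μ := hs.prod hσ.toMeasurePreserving
  refine ⟨hT, ⟨fun A hA hTA => ?_⟩⟩
  have hmeas : ∀ B : Set ((ℤ → V) × S), MeasurableSet B →
      Measurable fun x => η.real ((fun u => (u, x)) ⁻¹' B) := fun B hB =>
    (measurable_measure_prodMk_right hB).ennreal_toReal
  have hint : ∀ B : Set ((ℤ → V) × S), MeasurableSet B →
      Integrable (fun x => η.real ((fun u => (u, x)) ⁻¹' B)) ν := fun B hB =>
    Integrable.of_bound (hmeas B hB).aestronglyMeasurable 1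
      (Filter.Eventually.of_forall fun x => by
        rw [Real.norm_of_nonneg measureReal_nonneg]; exact measureReal_le_one)
  have hreal : ∀ B : Set ((ℤ → V) × S), MeasurableSet B →
      μ.real B = ∫ x, η.real ((fun u => (u, x)) ⁻¹' B) ∂ν := by
    intro B hB
    rw [Measure.real, Measure.prod_apply_symm hB]
    refine (integral_toReal ?_ ?_).symm
    · exact (measurable_measure_prodMk_right hB).aemeasurable
    · exact Filter.Eventually.of_forall fun x => measure_lt_top _ _
  set c := μ.real A
  -- The noise measure of the fibre of an invariant set is a `σ`-invariant function of `x`, hence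
  -- constant by ergodicity of `σ`.
  have hgc : ∀ᵐ x ∂ν, η.real ((fun u => (u, x)) ⁻¹' A) = c := by
    have hinv : (fun x => η.real ((fun u => (u, x)) ⁻¹' A)) ∘ σ =
        fun x => η.real ((fun u => (u, x)) ⁻¹' A) := by
      ext x
      simp only [Function.comp]
      conv_rhs => rw [← hTA]
      have : (fun u => (u, x)) ⁻¹' (Prod.map seqShift σ ⁻¹' A) =
        seqShift ⁻¹' ((fun u => (u, σ x)) ⁻¹' A) := rfl
      rw [this, Measure.real, Measure.real,
        hs.measure_preimage ((measurable_prodMk_right hA).nullMeasurableSet)]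
    obtain ⟨c', hc'⟩ := hσ.toPreErgodic.ae_eq_const_of_ae_eq_comp (hmeas A hA) hinv
    have : c = c' := by
      rw [show c = _ from hreal A hA, integral_congr_ae hc']
      simp
    rw [this]
    exact hc'
  -- Mixing argument for `c = c²`: with a window set `A'` that is `ε`-close to `A`, the measure of
  -- `A' ∩ T⁻¹ A'` is within `2ε` of `c`, by invariance of `A`, and within `2ε` of `c²`, by
  -- independence.
  have happrox : ∀ ε : ℝ, 0 < ε → |c - c * c| ≤ 4 * ε := by
    intro ε hε
    obtain ⟨A', ⟨J, B, hB, rfl⟩, hA'⟩ := (Measure.MeasureDense.of_generateFrom_isSetAlgebra_finite μ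
      isSetAlgebra_windowSets generateFrom_windowSets).approx A hA (measure_ne_top _ _) ε hε
    set A' := (fun z : (ℤ → V) × S => (J.restrict z.1, z.2)) ⁻¹' B with hA'def
    have hA'm : MeasurableSet A' := measurable_window J hB
    have hdiff : μ.real (A ∆ A') ≤ ε := by
      rw [Measure.real]
      exact ENNReal.toReal_le_of_le_ofReal hε.le hA'.le
    set g' : S → ℝ := fun x => η.real ((fun u => (u, x)) ⁻¹' A')
    have hg'int : Integrable (fun x => |g' x - c|) ν :=
      ((hint A' hA'm).sub (integrable_const c)).abs
    have hL1 : ∫ x, |g' x - c| ∂ν ≤ ε := by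
      refine le_trans ?_ hdiff
      rw [hreal _ (hA.symmDiff hA'm)]
      refine integral_mono_ae hg'int (hint _ (hA.symmDiff hA'm)) ?_
      filter_upwards [hgc] with x hx
      simp only [g']
      rw [← hx, abs_sub_comm]
      exact abs_measureReal_sub_le_measureReal_symmDiff
        (measurable_prodMk_right hA).nullMeasurableSet
        (measurable_prodMk_right hA'm).nullMeasurableSet
    -- A shift longer than the diameter of the window makes it disjoint from its translate.
    obtain ⟨m, hm⟩ : ∃ m : ℕ, ∀ i ∈ J, i + (m : ℤ) ∉ J := by
      obtain ⟨b, hb⟩ := J.bddAbove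
      obtain ⟨l, hl⟩ := J.bddBelow
      refine ⟨(b - l + 1).toNat, fun i hi hi' => ?_⟩
      have h1 := hb hi'
      have h2 := hl hi
      have h3 := Int.self_le_toNat (b - l + 1)
      omega
    set T := (Prod.map (seqShift : (ℤ → V) → _) σ)^[m] with hTdef
    have hTm : MeasurePreserving T μ μ := hT.iterate m
    have hσm : MeasurePreserving σ^[m] ν ν := hσ.toMeasurePreserving.iterate m
    have hTA' : T ⁻¹' A = A := by
      rw [hTdef, Set.preimage_iterate_eq]
      exact Function.iterate_fixed hTA m
    -- Independence is used fibrewise, for fixed `x`; no mixing of `σ` is needed because `g'` is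
    -- already `L¹`-close to the constant `c`.
    have hsec : ∀ x, η.real ((fun u => (u, x)) ⁻¹' (A' ∩ T ⁻¹' A')) = g' x * g' (σ^[m] x) := by
      intro x
      have h1 : (fun u => (u, x)) ⁻¹' (A' ∩ T ⁻¹' A') =
          {u | J.restrict (π := fun _ => V) u ∈ (fun w => (w, x)) ⁻¹' B} ∩
          {u | J.restrict (π := fun _ => V) (seqShift^[m] u) ∈ (fun w => (w, σ^[m] x)) ⁻¹' B} := by
        ext u
        simp [A', hTdef, Prod.map_iterate]
      have h2 : {u : ℤ → V | J.restrict (π := fun _ => V) (seqShift^[m] u) ∈ (fun w => (w, σ^[m] x)) ⁻¹' B} =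
          seqShift^[m] ⁻¹' ((fun u => (u, σ^[m] x)) ⁻¹' A') := rfl
      rw [h1, Measure.real, noiseLaw_inter_preimage_iterate κ J m hm (measurable_prodMk_right hB)
        (measurable_prodMk_right hB), ENNReal.toReal_mul, h2,
        (hs.iterate m).measure_preimage (measurable_prodMk_right hA'm).nullMeasurableSet]
      rfl
    have hg'01 : ∀ x, 0 ≤ g' x ∧ g' x ≤ 1 := fun x => ⟨measureReal_nonneg, measureReal_le_one⟩
    have hc01 : 0 ≤ c ∧ c ≤ 1 := ⟨measureReal_nonneg, measureReal_le_one⟩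
    have hmix : |μ.real (A' ∩ T ⁻¹' A') - c * c| ≤ 2 * ε := by
      have hTA'm : MeasurableSet (A' ∩ T ⁻¹' A') := hA'm.inter (hTm.measurable hA'm)
      have hshift : Integrable (fun x => |g' (σ^[m] x) - c|) ν :=
        hσm.integrable_comp_of_integrable hg'int
      have e : ∫ x, |g' (σ^[m] x) - c| ∂ν = ∫ x, |g' x - c| ∂ν := by
        have := integral_map (μ := ν) hσm.measurable.aemeasurable (f := fun x => |g' x - c|)
          (((hmeas A' hA'm).sub_const c).abs).aestronglyMeasurable
        rw [← this, hσm.map_eq]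
      have e2 : μ.real (A' ∩ T ⁻¹' A') - c * c = ∫ x, (g' x * g' (σ^[m] x) - c * c) ∂ν := by
        have hi : Integrable (fun x => g' x * g' (σ^[m] x)) ν := by
          simpa only [hsec] using hint _ hTA'm
        rw [integral_sub hi (integrable_const _), hreal _ hTA'm]
        simp only [hsec, integral_const, probReal_univ, one_smul]
      rw [e2]
      calc |∫ x, (g' x * g' (σ^[m] x) - c * c) ∂ν|
          ≤ ∫ x, |g' x * g' (σ^[m] x) - c * c| ∂ν := abs_integral_le_integral_abs
        _ ≤ ∫ x, (|g' x - c| + |g' (σ^[m] x) - c|) ∂ν := by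
            refine integral_mono_of_nonneg (Filter.Eventually.of_forall fun x => abs_nonneg _)
              (hg'int.add hshift) (Filter.Eventually.of_forall fun x => ?_)
            have : g' x * g' (σ^[m] x) - c * c =
              (g' x - c) * g' (σ^[m] x) + c * (g' (σ^[m] x) - c) := by ring
            simp only [this]
            refine (abs_add_le _ _).trans (add_le_add ?_ ?_)
            · rw [abs_mul, abs_of_nonneg (hg'01 _).1]
              exact mul_le_of_le_one_right (abs_nonneg _) (hg'01 _).2
            · rw [abs_mul, abs_of_nonneg hc01.1]
              exact mul_le_of_le_one_left (abs_nonneg _) hc01.2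
        _ = (∫ x, |g' x - c| ∂ν) + ∫ x, |g' (σ^[m] x) - c| ∂ν := integral_add hg'int hshift
        _ ≤ 2 * ε := by rw [e]; linarith
    have hnear : |c - μ.real (A' ∩ T ⁻¹' A')| ≤ 2 * ε := by
      have h1 : |μ.real A - μ.real (A' ∩ T ⁻¹' A')| ≤ μ.real (A ∆ (A' ∩ T ⁻¹' A')) :=
        abs_measureReal_sub_le_measureReal_symmDiff hA.nullMeasurableSet
          (hA'm.inter (hTm.measurable hA'm)).nullMeasurableSet
      have h2 : A ∆ (A' ∩ T ⁻¹' A') ⊆ (A ∆ A') ∪ T ⁻¹' (A ∆ A') := by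
        intro z hz
        have hz' : z ∈ A ↔ T z ∈ A := by
          conv_lhs => rw [← hTA']
          rfl
        simp only [Set.mem_symmDiff, Set.mem_inter_iff, Set.mem_preimage, Set.mem_union] at hz ⊢
        tauto
      have h3 : μ.real (T ⁻¹' (A ∆ A')) = μ.real (A ∆ A') := by
        rw [Measure.real, Measure.real,
          hTm.measure_preimage (hA.symmDiff hA'm).nullMeasurableSet]
      have h4 := (measureReal_mono h2 (by finiteness)).trans
        (measureReal_union_le (μ := μ) (A ∆ A') (T ⁻¹' (A ∆ A')))
      linarith
    calc |c - c * c| ≤ |c - μ.real (A' ∩ T ⁻¹' A')| + |μ.real (A' ∩ T ⁻¹' A') - c * c| :=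
          abs_sub_le _ _ _
      _ ≤ 4 * ε := by linarith
  have hzero : c - c * c = 0 := by
    by_contra hne
    have hpos := abs_pos.2 hne
    have := happrox (|c - c * c| / 8) (by positivity)
    linarith
  have hc : c = 0 ∨ c = 1 := by
    have : c * (1 - c) = 0 := by linarith
    rcases mul_eq_zero.1 this with h | h
    · exact Or.inl h
    · exact Or.inr (by linarith)
  rw [Filter.eventuallyConst_set]
  rcases hc with h | h
  · right
    have : μ A = 0 := (measureReal_eq_zero_iff).1 h
    exact measure_eq_zero_iff_ae_notMem.1 this
  · left
    have : μ A = 1 := by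
      rw [← ENNReal.toReal_eq_one_iff]; exact h
    exact (prob_compl_eq_zero_iff hA).2 this

end Ergodicity

open scoped unitInterval

/-! ### The recursion driven by uniform noise. -/

section Recursion

variable {d : ℕ} (F : ℝ → ℝ) (a : ℕ+ → ℝ) (γ : EuclideanSpace ℝ (Fin d))

/-- The latent variable as a function of the paths of the response and of the covariate. -/
noncomputable def score (y : ℤ → Fin 2) (x : ℤ → EuclideanSpace ℝ (Fin d)) (t : ℤ) : ℝ :=
  (∑' j : ℕ+, a j * ((y (t - (j : ℤ)) : ℕ) : ℝ)) + inner ℝ γ (x t)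

/-- The response at time `t` driven by the uniform variable `v`. -/
noncomputable def response (y : ℤ → Fin 2) (x : ℤ → EuclideanSpace ℝ (Fin d)) (t : ℤ) (v : I) :
    Fin 2 :=
  if (v : ℝ) ≤ F (score a γ y x t) then 1 else 0

/-- The path `y` after the responses at the times `s, …, s + n - 1` have been replaced
recursively. -/
noncomputable def run (s : ℤ) (y : ℤ → Fin 2) (u : ℤ → I) (x : ℤ → EuclideanSpace ℝ (Fin d)) :
    ℕ → ℤ → Fin 2
  | 0 => y
  | n + 1 => Function.update (run s y u x n) (s + n)
      (response F a γ (run s y u x n) x (s + n) (u (s + n)))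

/-- The path that is equal to `y` before time `s` and follows the recursion from time `s` on. -/
noncomputable def path (s : ℤ) (y : ℤ → Fin 2) (u : ℤ → I) (x : ℤ → EuclideanSpace ℝ (Fin d))
    (t : ℤ) : Fin 2 :=
  -- This number of steps just suffices to write the value at `t`; it is zero for `t < s`, where `y`
  -- is kept.
  run F a γ s y u x (t - s + 1).toNat t

/-- `y` follows the recursion from time `τ` on. -/
def SolvesFrom (τ : ℤ) (y : ℤ → Fin 2) (u : ℤ → I) (x : ℤ → EuclideanSpace ℝ (Fin d)) : Prop :=
  ∀ t, τ ≤ t → y t = response F a γ y x t (u t)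

variable {F a γ}
variable {y y' : ℤ → Fin 2} {u u' : ℤ → I} {x : ℤ → EuclideanSpace ℝ (Fin d)}

/-- Only lags `j ≥ 1` enter the sum. All later causality statements rest on this. -/
lemma score_congr {t : ℤ} (h : ∀ r < t, y r = y' r) : score a γ y x t = score a γ y' x t := by
  unfold score
  congr 1
  refine tsum_congr fun j => ?_
  rw [h _ (by have := j.pos; omega)]

lemma response_congr {t : ℤ} {v : I} (h : ∀ r < t, y r = y' r) :
    response F a γ y x t v = response F a γ y' x t v := by
  unfold response
  rw [score_congr h]

lemma run_of_lt {s t : ℤ} (h : t < s) (n : ℕ) : run F a γ s y u x n t = y t := by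
  induction n with
  | zero => rfl
  | succ n ih => rw [run, Function.update_of_ne (by omega), ih]

/-- Each step writes a single, new time, so values already written are final. -/
lemma run_stable {s t : ℤ} {m n : ℕ} (hmn : m ≤ n) (h : t < s + m) :
    run F a γ s y u x n t = run F a γ s y u x m t := by
  induction n, hmn using Nat.le_induction with
  | base => rfl
  | succ n hn ih => rw [run, Function.update_of_ne (by omega), ih]

lemma run_eq_path {s t : ℤ} {n : ℕ} (h : t < s + n) :
    run F a γ s y u x n t = path F a γ s y u x t := by
  rcases lt_or_ge t s with hts | hts
  · rw [path, run_of_lt hts, run_of_lt hts]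
  · rw [path]
    exact run_stable (by omega) (by omega)

lemma path_of_lt {s t : ℤ} (h : t < s) : path F a γ s y u x t = y t := run_of_lt h _

lemma path_solvesFrom (s : ℤ) : SolvesFrom F a γ s (path F a γ s y u x) u x := by
  intro t ht
  obtain ⟨n, rfl⟩ := Int.le.dest ht
  rw [← run_eq_path (n := n + 1) (by push_cast; omega), run, Function.update_self]
  exact response_congr fun r hr => run_eq_path hr

lemma SolvesFrom.mono {τ τ' : ℤ} (h : SolvesFrom F a γ τ y u x) (hτ : τ ≤ τ') :
    SolvesFrom F a γ τ' y u x := fun t ht => h t (hτ.trans ht)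

lemma eq_of_step {τ : ℤ} (h0 : ∀ t < τ, y t = y' t)
    (hstep : ∀ t, τ ≤ t → (∀ r < t, y r = y' r) → y t = y' t) : y = y' := by
  have : ∀ n : ℕ, ∀ t < τ + n, y t = y' t := by
    intro n
    induction n with
    | zero => simpa using h0
    | succ n ih =>
      intro t ht
      push_cast at ht
      rcases lt_or_ge t (τ + n) with h | h
      · exact ih t h
      · have : t = τ + n := by omega
        subst this
        exact hstep _ (by omega) ih
  ext1 t
  exact this (t - τ + 1).toNat t (by omega)

lemma SolvesFrom.eq {τ : ℤ} (h : SolvesFrom F a γ τ y u x) (h' : SolvesFrom F a γ τ y' u x)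
    (h0 : ∀ t < τ, y t = y' t) : y = y' :=
  eq_of_step h0 fun t ht hr => by rw [h t ht, h' t ht, response_congr hr]

lemma run_congr_noise {s : ℤ} {n : ℕ} (h : ∀ r, r < s + n → u r = u' r) :
    run F a γ s y u x n = run F a γ s y u' x n := by
  induction n with
  | zero => rfl
  | succ n ih =>
    push_cast at h
    rw [run, run, ih fun r hr => h r (by omega), h (s + n) (by omega)]

lemma path_congr_noise {s t : ℤ} (h : ∀ r ≤ t, u r = u' r) :
    path F a γ s y u x t = path F a γ s y u' x t := by
  rcases lt_or_ge t s with hts | hts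
  · rw [path_of_lt hts, path_of_lt hts]
  · rw [path, path, run_congr_noise fun r hr => h r (by omega)]

lemma score_seqShift (t : ℤ) :
    score a γ (seqShift y) (seqShift x) t = score a γ y x (t + 1) := by
  simp only [score, seqShift, sub_add_eq_add_sub]

lemma response_seqShift (t : ℤ) (v : I) :
    response F a γ (seqShift y) (seqShift x) t v = response F a γ y x (t + 1) v := by
  simp only [response, score_seqShift]

lemma SolvesFrom.seqShift {τ : ℤ} (h : SolvesFrom F a γ (τ + 1) y u x) :
    SolvesFrom F a γ τ (seqShift y) (seqShift u) (seqShift x) := fun t ht => by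
  rw [response_seqShift]
  exact h (t + 1) (by omega)

lemma path_seqShift (s : ℤ) :
    path F a γ s (seqShift y) (seqShift u) (seqShift x) = seqShift (path F a γ (s + 1) y u x) :=
  (path_solvesFrom s).eq (path_solvesFrom (s + 1)).seqShift fun t ht => by
    rw [path_of_lt ht]
    exact (path_of_lt (s := s + 1) (t := t + 1) (by omega)).symm

end Recursion

/-! ### Regeneration times and the loss of memory. -/

section Regeneration

variable {d : ℕ} (F : ℝ → ℝ) (a : ℕ+ → ℝ) (γ : EuclideanSpace ℝ (Fin d)) (L : ℝ)

/-- The tail sums `∑_{j > k} |a_j|`. -/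
noncomputable def tailSum (k : ℕ) : ℝ := ∑' j : ℕ+, if k < (j : ℕ) then |a j| else 0

/-- The noise at time `τ + k` determines the response independently of what happened before
time `τ`. -/
def ForgetsAt (τ : ℤ) (k : ℕ) (u : ℤ → I) (x : ℤ → EuclideanSpace ℝ (Fin d)) : Prop :=
  (u (τ + k) : ℝ) ≤ F (-(∑' j, |a j|) + inner ℝ γ (x (τ + k))) ∨
    L * tailSum a k < |(u (τ + k) : ℝ) - F (score a γ (path F a γ τ 0 u x) x (τ + k))|

/-- The responses from time `τ` on do not depend on what happened before time `τ`. -/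
def Regenerates (τ : ℤ) (u : ℤ → I) (x : ℤ → EuclideanSpace ℝ (Fin d)) : Prop :=
  ∀ k, ForgetsAt F a γ L τ k u x

variable {F a γ L}
variable {y y' : ℤ → Fin 2} {u u' : ℤ → I} {x : ℤ → EuclideanSpace ℝ (Fin d)}

lemma summable_abs_of_moment (ha : Summable fun j : ℕ+ => ((j : ℕ) : ℝ) * |a j|) :
    Summable fun j => |a j| :=
  ha.of_nonneg_of_le (fun _ => abs_nonneg _) fun j =>
    le_mul_of_one_le_left (abs_nonneg _) (by exact_mod_cast one_le)

lemma tailSum_nonneg (k : ℕ) : 0 ≤ tailSum a k :=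
  tsum_nonneg fun j => by split_ifs <;> positivity

/-- Exchange of summation: `|a_j|` is counted once for each `k < j`, that is `j` times. This is
where the first moment of the coefficients is needed in full. -/
lemma summable_tailSum (ha : Summable fun j : ℕ+ => ((j : ℕ) : ℝ) * |a j|) :
    Summable (tailSum a) := by
  have hrow : ∀ j : ℕ+, HasSum (fun k : ℕ => if k < (j : ℕ) then |a j| else 0)
      (((j : ℕ) : ℝ) * |a j|) := by
    intro j
    have h : HasSum (fun k : ℕ => if k < (j : ℕ) then |a j| else 0)
        (∑ k ∈ Finset.range j, if k < (j : ℕ) then |a j| else 0) :=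
      hasSum_sum_of_ne_finset_zero fun k hk => if_neg (by simpa using hk)
    convert h using 1
    rw [Finset.sum_congr rfl fun k hk => if_pos (Finset.mem_range.1 hk)]
    simp
  have h : Summable fun p : ℕ+ × ℕ => if p.2 < (p.1 : ℕ) then |a p.1| else 0 := by
    rw [summable_prod_of_nonneg fun p => by dsimp only [Pi.zero_apply]; split_ifs <;> positivity]
    refine ⟨fun j => (hrow j).summable, ?_⟩
    simpa only [(hrow _).tsum_eq] using ha
  exact h.prod_symm.prod

variable (a) in
lemma summable_coeff_mul (ha : Summable fun j => |a j|) (y : ℤ → Fin 2) (t : ℤ) :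
    Summable fun j : ℕ+ => a j * ((y (t - (j : ℤ)) : ℕ) : ℝ) := by
  refine Summable.of_norm_bounded ha fun j => ?_
  rw [Real.norm_eq_abs, abs_mul]
  refine mul_le_of_le_one_right (abs_nonneg _) ?_
  rw [Nat.abs_cast]
  exact_mod_cast Nat.le_of_lt_succ (y _).2

/-- Lags `j ≤ k` cancel, and a lag `j > k` contributes at most `|a_j|` because responses lie in
`{0,1}`. -/
lemma abs_score_sub_le (ha : Summable fun j => |a j|) {t : ℤ} {k : ℕ}
    (h : ∀ r, t - k ≤ r → r < t → y r = y' r) :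
    |score a γ y x t - score a γ y' x t| ≤ tailSum a k := by
  have hs := (summable_coeff_mul a ha y t).sub (summable_coeff_mul a ha y' t)
  have hbd : ∀ j : ℕ+, ‖a j * ((y (t - (j : ℤ)) : ℕ) : ℝ) - a j * ((y' (t - (j : ℤ)) : ℕ) : ℝ)‖ ≤
      if k < (j : ℕ) then |a j| else 0 := by
    intro j
    split_ifs with hk
    · rw [← mul_sub, Real.norm_eq_abs, abs_mul]
      refine mul_le_of_le_one_right (abs_nonneg _) ?_
      have h1 : ((y (t - (j : ℤ)) : ℕ) : ℝ) ≤ 1 := by exact_mod_cast Nat.le_of_lt_succ (y _).2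
      have h2 : ((y' (t - (j : ℤ)) : ℕ) : ℝ) ≤ 1 := by exact_mod_cast Nat.le_of_lt_succ (y' _).2
      have h3 : (0 : ℝ) ≤ ((y (t - (j : ℤ)) : ℕ) : ℝ) := Nat.cast_nonneg _
      have h4 : (0 : ℝ) ≤ ((y' (t - (j : ℤ)) : ℕ) : ℝ) := Nat.cast_nonneg _
      rw [abs_le]
      constructor <;> linarith
    · rw [h _ (by omega) (by have := j.pos; omega)]
      simp
  have hsum : Summable fun j : ℕ+ => if k < (j : ℕ) then |a j| else 0 :=
    ha.of_nonneg_of_le (fun j => by split_ifs <;> positivity) fun j => by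
      split_ifs
      · exact le_rfl
      · positivity
  have e : score a γ y x t - score a γ y' x t =
      ∑' j : ℕ+, (a j * ((y (t - (j : ℤ)) : ℕ) : ℝ) - a j * ((y' (t - (j : ℤ)) : ℕ) : ℝ)) := by
    rw [(summable_coeff_mul a ha y t).tsum_sub (summable_coeff_mul a ha y' t)]
    simp [score]
  rw [e, ← Real.norm_eq_abs]
  exact tsum_of_norm_bounded hsum.hasSum hbd

lemma le_score (ha : Summable fun j => |a j|) (t : ℤ) :
    -(∑' j, |a j|) + inner ℝ γ (x t) ≤ score a γ y x t := by
  have h := abs_score_sub_le (y := y) (y' := 0) (γ := γ) (x := x) (t := t) (k := 0) ha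
    (fun r h1 h2 => by simp at h1; omega)
  have e0 : score a γ (0 : ℤ → Fin 2) x t = inner ℝ γ (x t) := by simp [score]
  have e1 : tailSum a 0 = ∑' j, |a j| := tsum_congr fun j => if_pos j.pos
  rw [e0, e1, abs_le] at h
  linarith [h.1]

section

variable (hmono : Monotone F) (hlip : ∀ p q, |F p - F q| ≤ L * |p - q|) (hL : 0 ≤ L)
  (ha : Summable fun j => |a j|)

include hmono hlip hL ha

/-- In the first alternative both thresholds exceed the noise. In the second, the thresholds differ
by at most `L * tailSum a k`, less than the distance from the noise to one of them. -/
lemma ForgetsAt.response_eq {τ : ℤ} {k : ℕ} (h : ForgetsAt F a γ L τ k u x)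
    (hy : ∀ r, τ ≤ r → r < τ + k → y r = path F a γ τ 0 u x r) :
    response F a γ y x (τ + k) (u (τ + k)) = path F a γ τ 0 u x (τ + k) := by
  rw [path_solvesFrom τ (τ + k) (by omega)]
  unfold response
  rcases h with h | h
  · rw [if_pos (h.trans (hmono (le_score ha _))), if_pos (h.trans (hmono (le_score ha _)))]
  · have h1 := abs_score_sub_le (y := y) (y' := path F a γ τ 0 u x) (γ := γ) (x := x)
      (t := τ + k) (k := k) ha fun r h1 h2 => hy r (by omega) h2
    have h2 := (hlip (score a γ y x (τ + k)) (score a γ (path F a γ τ 0 u x) x (τ + k))).trans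
      (mul_le_mul_of_nonneg_left h1 hL)
    have h3 := h2.trans_lt h
    -- By `h3` the threshold `p` is closer to `q` than the noise `v` is, so `p` and `q` lie on the
    -- same side of `v`.
    congr 1
    rw [eq_iff_iff]
    set p := F (score a γ y x (τ + k))
    set q := F (score a γ (path F a γ τ 0 u x) x (τ + k))
    set v : ℝ := (u (τ + k) : ℝ)
    rw [abs_lt] at h3
    constructor
    · intro hv
      by_contra hq
      rw [abs_of_pos (by linarith)] at h3
      linarith [h3.2]
    · intro hv
      by_contra hq
      rw [abs_of_nonpos (by linarith)] at h3
      linarith [h3.1]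

lemma Regenerates.eq_path {τ : ℤ} (h : Regenerates F a γ L τ u x)
    (hy : SolvesFrom F a γ τ y u x) {t : ℤ} (ht : τ ≤ t) : y t = path F a γ τ 0 u x t := by
  have : ∀ n : ℕ, ∀ t, τ ≤ t → t < τ + n → y t = path F a γ τ 0 u x t := by
    intro n
    induction n with
    | zero => intro t h1 h2; simp at h2; omega
    | succ n ih =>
      intro t h1 h2
      push_cast at h2
      rcases lt_or_ge t (τ + n) with h3 | h3
      · exact ih t h1 h3
      · have : t = τ + n := by omega
        subst this
        rw [hy _ h1, (h n).response_eq hmono hlip hL ha ih]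
  exact this (t - τ + 1).toNat t ht (by omega)

/-- Converse of `Regenerates.eq_path`: the values of `y` before `τ` are arbitrary, yet the recursion
for `y` itself holds from `τ` on. This shows that the limit path is a solution. -/
lemma Regenerates.solvesFrom {τ : ℤ} (h : Regenerates F a γ L τ u x)
    (hy : ∀ t, τ ≤ t → y t = path F a γ τ 0 u x t) : SolvesFrom F a γ τ y u x := by
  intro t ht
  obtain ⟨n, rfl⟩ := Int.le.dest ht
  rw [hy _ ht, (h n).response_eq hmono hlip hL ha fun r h1 _ => hy r h1]

end

lemma forgetsAt_seqShift (τ : ℤ) (k : ℕ) :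
    ForgetsAt F a γ L τ k (seqShift u) (seqShift x) ↔ ForgetsAt F a γ L (τ + 1) k u x := by
  have h0 : path F a γ τ 0 (seqShift u) (seqShift x) = seqShift (path F a γ (τ + 1) 0 u x) :=
    path_seqShift (y := 0) τ
  unfold ForgetsAt
  rw [h0, score_seqShift, add_right_comm τ 1 (k : ℤ)]
  rfl

lemma regenerates_seqShift (τ : ℤ) :
    Regenerates F a γ L τ (seqShift u) (seqShift x) ↔ Regenerates F a γ L (τ + 1) u x :=
  forall_congr' fun k => forgetsAt_seqShift τ k

end Regeneration

/-! ### The stationary solution as a limit from the remote past. -/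

section LimitPath

variable {d : ℕ} (F : ℝ → ℝ) (a : ℕ+ → ℝ) (γ : EuclideanSpace ℝ (Fin d)) (L : ℝ)

open scoped Classical in
/-- The limit of the paths started from the zero past at a time tending to `-∞`. -/
noncomputable def limitPath (u : ℤ → I) (x : ℤ → EuclideanSpace ℝ (Fin d)) (t : ℤ) : Fin 2 :=
  -- The value is also `0` where there is no limit, which cannot happen for recurrent noise and
  -- covariate.
  if ∀ᶠ n : ℕ in Filter.atTop, path F a γ (-(n : ℤ)) 0 u x t = 1 then 1 else 0

/-- There are regeneration times arbitrarily far in the past. -/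
def Recurrent (u : ℤ → I) (x : ℤ → EuclideanSpace ℝ (Fin d)) : Prop :=
  ∃ᶠ n : ℕ in Filter.atTop, Regenerates F a γ L (-(n : ℤ)) u x

variable {F a γ L}
variable {y y' : ℤ → Fin 2} {u u' : ℤ → I} {x : ℤ → EuclideanSpace ℝ (Fin d)}

lemma Recurrent.exists_regenerates (h : Recurrent F a γ L u x) (t : ℤ) :
    ∃ τ ≤ t, Regenerates F a γ L τ u x := by
  obtain ⟨n, hn, hr⟩ := Filter.frequently_atTop.1 h (-t).toNat
  exact ⟨-n, by omega, hr⟩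

open scoped Classical in
-- Causality of the limit: it makes the noise at a later time independent of the history built so
-- far.
lemma limitPath_congr_noise {t : ℤ} (h : ∀ r ≤ t, u r = u' r) :
    limitPath F a γ u x t = limitPath F a γ u' x t := by
  unfold limitPath
  have h' : ∀ n : ℕ, path F a γ (-(n : ℤ)) 0 u x t = path F a γ (-(n : ℤ)) 0 u' x t :=
    fun n => path_congr_noise h
  refine if_congr (Filter.eventually_congr (Filter.Eventually.of_forall fun n => ?_)) rfl rfl
  rw [h']

variable (hmono : Monotone F) (hlip : ∀ p q, |F p - F q| ≤ L * |p - q|) (hL : 0 ≤ L)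
  (ha : Summable fun j => |a j|)

include hmono hlip hL ha

/-- Every path started at or before `τ` solves the recursion from `τ` on, hence has the same values
there, so the limit is attained. -/
lemma Regenerates.limitPath_eq {τ : ℤ} (h : Regenerates F a γ L τ u x) {t : ℤ} (ht : τ ≤ t) :
    limitPath F a γ u x t = path F a γ τ 0 u x t := by
  have hev : ∀ᶠ n : ℕ in Filter.atTop,
      path F a γ (-(n : ℤ)) 0 u x t = path F a γ τ 0 u x t := by
    filter_upwards [Filter.eventually_ge_atTop (-τ).toNat] with n hn
    exact h.eq_path hmono hlip hL ha ((path_solvesFrom _).mono (by omega)) ht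
  unfold limitPath
  by_cases h1 : path F a γ τ 0 u x t = 1
  · rw [if_pos, h1]
    exact hev.mono fun n hn => hn.trans h1
  · rw [if_neg]
    · have := (path F a γ τ 0 u x t).2
      ext
      have h2 : (path F a γ τ 0 u x t : ℕ) ≠ 1 := fun h => h1 (Fin.ext h)
      simp only [Fin.val_zero]
      omega
    · intro h2
      obtain ⟨n, hn, hn'⟩ := (hev.and h2).exists
      exact h1 (hn.symm.trans hn')

lemma Recurrent.limitPath_eq_response (h : Recurrent F a γ L u x) (t : ℤ) :
    limitPath F a γ u x t = response F a γ (limitPath F a γ u x) x t (u t) := by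
  obtain ⟨τ, hτ, hr⟩ := h.exists_regenerates t
  exact hr.solvesFrom hmono hlip hL ha (fun r hr' => hr.limitPath_eq hmono hlip hL ha hr') t hτ

lemma Recurrent.eq_limitPath (h : Recurrent F a γ L u x)
    (hy : ∀ t, y t = response F a γ y x t (u t)) : y = limitPath F a γ u x := by
  ext1 t
  obtain ⟨τ, hτ, hr⟩ := h.exists_regenerates t
  rw [hr.limitPath_eq hmono hlip hL ha hτ, hr.eq_path hmono hlip hL ha (fun r _ => hy r) hτ]

/-- The limit starts paths at fixed times, so equivariance is not built in; it follows from pathwise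
uniqueness, the shifted limit being a solution for the shifted data. -/
lemma Recurrent.limitPath_seqShift (h : Recurrent F a γ L u x)
    (h' : Recurrent F a γ L (seqShift u) (seqShift x)) :
    limitPath F a γ (seqShift u) (seqShift x) = seqShift (limitPath F a γ u x) := by
  refine (h'.eq_limitPath hmono hlip hL ha fun t => ?_).symm
  rw [response_seqShift]
  exact h.limitPath_eq_response hmono hlip hL ha (t + 1)

end LimitPath

/-! ### Measurability of the recursion, the limit and the regeneration events. -/

section Measurability

variable {α : Type*} [MeasurableSpace α] {d : ℕ} {F : ℝ → ℝ} {a : ℕ+ → ℝ}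
  {γ : EuclideanSpace ℝ (Fin d)} {L : ℝ}
  {y : α → ℤ → Fin 2} {u : α → ℤ → I} {x : α → ℤ → EuclideanSpace ℝ (Fin d)}

lemma Measurable.update_coord {V : Type*} [MeasurableSpace V] {f : α → ℤ → V} {g : α → V}
    (hf : Measurable f) (hg : Measurable g) (k : ℤ) :
    Measurable fun w => Function.update (f w) k (g w) := by
  refine measurable_pi_lambda _ fun i => ?_
  by_cases h : i = k
  · subst h; simpa using hg
  · simpa only [Function.update_of_ne h] using measurable_pi_iff.1 hf i

lemma measurable_score (hy : Measurable y) (hx : Measurable x) (t : ℤ) :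
    Measurable fun w => score a γ (y w) (x w) t := by
  unfold score
  refine Measurable.add (Measurable.tsum fun j => ?_) ?_
  · refine measurable_const.mul ?_
    exact (measurable_from_top (f := fun i : Fin 2 => ((i : ℕ) : ℝ))).comp
      (measurable_pi_iff.1 hy _)
  · exact (measurable_pi_iff.1 hx t).const_inner

lemma measurable_response (hF : Measurable F) (hy : Measurable y) (hx : Measurable x) (t : ℤ)
    {v : α → I} (hv : Measurable v) :
    Measurable fun w => response F a γ (y w) (x w) t (v w) :=
  Measurable.ite (measurableSet_le (measurable_subtype_coe.comp hv)
    (hF.comp (measurable_score hy hx t))) measurable_const measurable_const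

lemma measurable_run (hF : Measurable F) (s : ℤ) (hy : Measurable y) (hu : Measurable u)
    (hx : Measurable x) (n : ℕ) : Measurable fun w => run F a γ s (y w) (u w) (x w) n := by
  induction n with
  | zero => exact hy
  | succ n ih => exact ih.update_coord (measurable_response hF ih hx _ (measurable_pi_iff.1 hu _)) _

lemma measurable_path (hF : Measurable F) (s : ℤ) (hy : Measurable y) (hu : Measurable u)
    (hx : Measurable x) : Measurable fun w => path F a γ s (y w) (u w) (x w) :=
  measurable_pi_lambda _ fun t => measurable_pi_iff.1 (measurable_run hF s hy hu hx _) t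

lemma measurable_limitPath (hF : Measurable F) (hu : Measurable u) (hx : Measurable x) :
    Measurable fun w => limitPath F a γ (u w) (x w) := by
  refine measurable_pi_lambda _ fun t => ?_
  unfold limitPath
  refine Measurable.ite ?_ measurable_const measurable_const
  have h : ∀ n : ℕ, MeasurableSet {w | path F a γ (-(n : ℤ)) 0 (u w) (x w) t = 1} := fun n =>
    measurable_pi_iff.1 (measurable_path hF _ measurable_const hu hx) t
      (measurableSet_singleton (1 : Fin 2))
  simp only [Filter.eventually_atTop, Set.ofPred_exists, Set.ofPred_forall]
  exact MeasurableSet.iUnion fun N => MeasurableSet.iInter fun n => MeasurableSet.iInter fun _ => h n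

lemma measurableSet_forgetsAt (hF : Measurable F) (hu : Measurable u) (hx : Measurable x) (τ : ℤ)
    (k : ℕ) : MeasurableSet {w | ForgetsAt F a γ L τ k (u w) (x w)} := by
  have hv : Measurable fun w => (u w (τ + k) : ℝ) :=
    measurable_subtype_coe.comp (measurable_pi_iff.1 hu _)
  refine MeasurableSet.union (measurableSet_le hv (hF.comp ?_)) (measurableSet_lt measurable_const
    (continuous_abs.measurable.comp (hv.sub (hF.comp ?_))))
  · exact ((measurable_pi_iff.1 hx _).const_inner).const_add _
  · exact measurable_score (measurable_path hF _ measurable_const hu hx) hx _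

lemma measurableSet_regenerates (hF : Measurable F) (hu : Measurable u) (hx : Measurable x)
    (τ : ℤ) : MeasurableSet {w | Regenerates F a γ L τ (u w) (x w)} := by
  simp only [Regenerates, Set.ofPred_forall]
  exact MeasurableSet.iInter fun k => measurableSet_forgetsAt hF hu hx τ k

end Measurability

/-! ### Integrating out one noise coordinate. -/

section Fresh

variable {V S : Type*} [MeasurableSpace V] [MeasurableSpace S] (κ : Measure V)
  [IsProbabilityMeasure κ] (ν : Measure S) [IsProbabilityMeasure ν]

lemma lintegral_update_noiseLaw (k : ℤ) {f : (ℤ → V) × S → ENNReal} (hf : Measurable f) :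
    ∫⁻ z, f z ∂((noiseLaw κ).prod ν) =
      ∫⁻ z, ∫⁻ v, f (Function.update z.1 k v, z.2) ∂κ ∂((noiseLaw κ).prod ν) := by
  have hg : Measurable fun p : ((ℤ → V) × S) × V => f (Function.update p.1.1 k p.2, p.1.2) :=
    hf.comp (((measurable_fst.comp measurable_fst).update_coord measurable_snd k).prodMk
      (measurable_snd.comp measurable_fst))
  rw [lintegral_prod_symm' f hf, lintegral_prod_symm' _ hg.lintegral_prod_right']
  refine lintegral_congr fun s => ?_
  have h1 : Measurable fun u : ℤ → V => f (u, s) := hf.comp measurable_prodMk_right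
  rw [← (measurePreserving_update_noiseLaw κ k).lintegral_comp h1]
  exact lintegral_prod _ (h1.comp (measurePreserving_update_noiseLaw κ k).measurable).aemeasurable

/-- If the event `A` and the random set `D` do not involve the coordinate `k` of the noise, then
this coordinate is independent of them. -/
lemma measure_inter_coord_mem (k : ℤ) {A : Set ((ℤ → V) × S)} (hA : MeasurableSet A)
    {D : Set (((ℤ → V) × S) × V)} (hD : MeasurableSet D)
    (hAk : ∀ z v, (Function.update z.1 k v, z.2) ∈ A ↔ z ∈ A)
    (hDk : ∀ z v w, ((Function.update z.1 k v, z.2), w) ∈ D ↔ (z, w) ∈ D) :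
    (noiseLaw κ).prod ν (A ∩ {z | (z, z.1 k) ∈ D}) =
      ∫⁻ z in A, κ {v | (z, v) ∈ D} ∂((noiseLaw κ).prod ν) := by
  have hm : MeasurableSet {z : (ℤ → V) × S | (z, z.1 k) ∈ D} :=
    (measurable_id.prodMk ((measurable_pi_apply k).comp measurable_fst)) hD
  rw [← lintegral_indicator_one (hA.inter hm),
    lintegral_update_noiseLaw κ ν k (measurable_one.indicator (hA.inter hm)),
    ← lintegral_indicator hA]
  refine lintegral_congr fun z => ?_
  by_cases hz : z ∈ A
  · rw [Set.indicator_of_mem hz, show {v | (z, v) ∈ D} = Prod.mk z ⁻¹' D from rfl,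
      ← lintegral_indicator_one (measurable_prodMk_left hD)]
    refine lintegral_congr fun v => ?_
    by_cases hv : (z, v) ∈ D
    · rw [Set.indicator_of_mem, Set.indicator_of_mem]
      · rfl
      · exact hv
      · refine ⟨(hAk z v).2 hz, ?_⟩
        simpa using (hDk z v v).2 hv
    · rw [Set.indicator_of_notMem, Set.indicator_of_notMem]
      · exact hv
      · rintro ⟨-, h⟩
        exact hv ((hDk z v v).1 (by simpa using h))
  · rw [Set.indicator_of_notMem hz]
    refine (lintegral_congr fun v => ?_).trans lintegral_zero
    exact Set.indicator_of_notMem (fun h => hz ((hAk z v).1 h.1)) _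

end Fresh

/-! ### Positive probability of regeneration and almost sure recurrence. -/

section Recurrence

lemma volume_unitInterval_le {p : ℝ} (h0 : 0 ≤ p) (h1 : p ≤ 1) :
    volume {v : I | (v : ℝ) ≤ p} = ENNReal.ofReal p :=
  unitInterval.volume_Iic ⟨p, h0, h1⟩

lemma le_volume_unitInterval_far (p r : ℝ) (hr : 0 ≤ r) :
    ENNReal.ofReal (1 - 2 * r) ≤ volume {v : I | r < |(v : ℝ) - p|} := by
  have hm : MeasurableSet {v : I | |(v : ℝ) - p| ≤ r} :=
    measurableSet_le (by fun_prop) measurable_const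
  have hc : {v : I | r < |(v : ℝ) - p|} = {v : I | |(v : ℝ) - p| ≤ r}ᶜ := by
    ext v; simp
  have hle : volume {v : I | |(v : ℝ) - p| ≤ r} ≤ ENNReal.ofReal (2 * r) := by
    rw [unitInterval.volume_apply]
    refine (measure_mono (t := Set.Icc (p - r) (p + r)) ?_).trans ?_
    · rintro _ ⟨v, hv, rfl⟩
      rw [Set.mem_ofPred_eq] at hv
      have := abs_le.1 hv
      constructor <;> linarith [this.1, this.2]
    · rw [Real.volume_Icc]
      exact ENNReal.ofReal_le_ofReal (by linarith)
  rw [hc, prob_compl_eq_one_sub hm, ENNReal.ofReal_sub _ (by positivity), ENNReal.ofReal_one]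
  exact tsub_le_tsub_left hle 1

variable {d : ℕ} {F : ℝ → ℝ} {a : ℕ+ → ℝ} {γ : EuclideanSpace ℝ (Fin d)} {L : ℝ}
  (ν : Measure (ℤ → EuclideanSpace ℝ (Fin d))) [IsProbabilityMeasure ν]

/-- The event that the noise at the times `0, …, k - 1` forgets the past before time `0`. -/
def forgetsUpTo (F : ℝ → ℝ) (a : ℕ+ → ℝ) (γ : EuclideanSpace ℝ (Fin d)) (L : ℝ) (k : ℕ) :
    Set ((ℤ → I) × (ℤ → EuclideanSpace ℝ (Fin d))) :=
  {z | ∀ j < k, ForgetsAt F a γ L 0 j z.1 z.2}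

lemma measurableSet_forgetsUpTo (hF : Measurable F) (k : ℕ) :
    MeasurableSet (forgetsUpTo F a γ L k) := by
  simp only [forgetsUpTo, Set.ofPred_forall]
  exact MeasurableSet.iInter fun j => MeasurableSet.iInter fun _ =>
    measurableSet_forgetsAt hF measurable_fst measurable_snd 0 j

/-- The values of the noise at time `k` that forget the past before time `0`. -/
def forgettingValues (F : ℝ → ℝ) (a : ℕ+ → ℝ) (γ : EuclideanSpace ℝ (Fin d)) (L : ℝ) (k : ℕ) :
    Set (((ℤ → I) × (ℤ → EuclideanSpace ℝ (Fin d))) × I) :=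
  {p | (p.2 : ℝ) ≤ F (-(∑' j, |a j|) + inner ℝ γ (p.1.2 (0 + k))) ∨
    L * tailSum a k < |(p.2 : ℝ) - F (score a γ (path F a γ 0 0 p.1.1 p.1.2) p.1.2 (0 + k))|}

/-- Whether step `k` forgets depends on the noise at time `k` only through a set determined by
earlier noise and the covariate, so that coordinate can be integrated out separately. -/
lemma measure_forgetsUpTo_succ (hF : Measurable F) (k : ℕ) :
    (noiseLaw (volume : Measure I)).prod ν (forgetsUpTo F a γ L (k + 1)) =
      ∫⁻ z in forgetsUpTo F a γ L k, volume {v | (z, v) ∈ forgettingValues F a γ L k}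
        ∂((noiseLaw (volume : Measure I)).prod ν) := by
  have hD : MeasurableSet (forgettingValues F a γ L k) := by
    have hv : Measurable fun p : ((ℤ → I) × (ℤ → EuclideanSpace ℝ (Fin d))) × I => (p.2 : ℝ) :=
      measurable_subtype_coe.comp measurable_snd
    have hx : Measurable fun p : ((ℤ → I) × (ℤ → EuclideanSpace ℝ (Fin d))) × I => p.1.2 :=
      measurable_snd.comp measurable_fst
    refine MeasurableSet.union (measurableSet_le hv (hF.comp ?_)) (measurableSet_lt measurable_const
      (continuous_abs.measurable.comp (hv.sub (hF.comp ?_))))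
    · exact ((measurable_pi_iff.1 hx _).const_inner).const_add _
    · exact measurable_score (measurable_path hF _ measurable_const
        (measurable_fst.comp measurable_fst) hx) hx _
  have hpath : ∀ (u : ℤ → I) (x : ℤ → EuclideanSpace ℝ (Fin d)) (v : I) (r : ℤ), r < 0 + k →
      path F a γ 0 0 (Function.update u (0 + k) v) x r = path F a γ 0 0 u x r := fun u x v r hr =>
    path_congr_noise fun q hq => Function.update_of_ne (by omega) _ _
  rw [← measure_inter_coord_mem volume ν (0 + k) (measurableSet_forgetsUpTo hF k) hD]
  · congr 1
    ext z
    simp only [forgetsUpTo, Set.mem_ofPred_eq, Set.mem_inter_iff, Nat.lt_succ_iff_lt_or_eq]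
    constructor
    · exact fun h => ⟨fun j hj => h j (Or.inl hj), h k (Or.inr rfl)⟩
    · rintro ⟨h1, h2⟩ j (hj | rfl)
      · exact h1 j hj
      · exact h2
  · intro z v
    refine forall₂_congr fun j hj => ?_
    have hne : (0 + j : ℤ) ≠ 0 + k := by omega
    simp only [ForgetsAt]
    rw [Function.update_of_ne hne,
      score_congr (y := path F a γ 0 0 (Function.update z.1 (0 + k) v) z.2)
        fun r hr => hpath z.1 z.2 v r (by omega)]
  · intro z v w
    simp only [forgettingValues, Set.mem_ofPred_eq]
    rw [score_congr (y := path F a γ 0 0 (Function.update z.1 (0 + k) v) z.2)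
      fun r hr => hpath z.1 z.2 v r hr]

variable (hF : Measurable F) (hpos : ∀ p, 0 < F p) (hF1 : ∀ p, F p ≤ 1) (hL : 0 ≤ L)
  (ha : Summable fun j : ℕ+ => ((j : ℕ) : ℝ) * |a j|)

include hF hpos hF1 hL ha

lemma measure_regenerates_zero_pos :
    0 < (noiseLaw (volume : Measure I)).prod ν {z | Regenerates F a γ L 0 z.1 z.2} := by
  set μ := (noiseLaw (volume : Measure I)).prod ν
  set A := forgetsUpTo F a γ L
  have hAm : ∀ k, MeasurableSet (A k) := measurableSet_forgetsUpTo hF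
  -- The forced-`1` alternative keeps every finite stage positive; this covers the early steps,
  -- where the bound `1 - 2 * (L * tailSum a k)` may be negative.
  have hApos : ∀ k, 0 < μ (A k) := by
    intro k
    induction k with
    | zero => simp [A, forgetsUpTo]
    | succ k ih =>
      rw [measure_forgetsUpTo_succ ν hF]
      set p : (ℤ → I) × (ℤ → EuclideanSpace ℝ (Fin d)) → ℝ := fun z =>
        F (-(∑' j, |a j|) + inner ℝ γ (z.2 (0 + k)))
      have hpm : Measurable fun z => ENNReal.ofReal (p z) := by
        refine (hF.comp ?_).ennreal_ofReal
        exact ((measurable_pi_iff.1 measurable_snd _).const_inner).const_add _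
      calc (0 : ENNReal) < ∫⁻ z in A k, ENNReal.ofReal (p z) ∂μ := by
            rw [setLIntegral_pos_iff hpm]
            have : (Function.support fun z => ENNReal.ofReal (p z)) = Set.univ := by
              ext z
              simp [p, hpos]
            rw [this, Set.univ_inter]
            exact ih
        _ ≤ _ := by
            refine lintegral_mono fun z => ?_
            rw [← volume_unitInterval_le (hpos _).le (hF1 _)]
            exact measure_mono fun v hv => Or.inl hv
  have hstep : ∀ k, (1 - 2 * (L * tailSum a k)) * μ.real (A k) ≤ μ.real (A (k + 1)) := by
    intro k
    rcases le_or_gt (1 - 2 * (L * tailSum a k)) 0 with h | h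
    · exact (mul_nonpos_of_nonpos_of_nonneg h measureReal_nonneg).trans measureReal_nonneg
    have h1 : ENNReal.ofReal (1 - 2 * (L * tailSum a k)) * μ (A k) ≤ μ (A (k + 1)) := by
      rw [measure_forgetsUpTo_succ ν hF, ← setLIntegral_const]
      refine lintegral_mono fun z => ?_
      refine (le_volume_unitInterval_far
        (F (score a γ (path F a γ 0 0 z.1 z.2) z.2 (0 + k))) _ (mul_nonneg hL (tailSum_nonneg k))).trans ?_
      exact measure_mono fun v hv => Or.inr hv
    have h2 := ENNReal.toReal_mono (measure_ne_top μ _) h1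
    rwa [ENNReal.toReal_mul, ENNReal.toReal_ofReal h.le] at h2
  have hsum : Summable fun k => 2 * (L * tailSum a k) :=
    ((summable_tailSum ha).mul_left L).mul_left 2
  set t : ℕ → ℝ := fun k => 2 * (L * tailSum a k)
  have ht0 : ∀ k, 0 ≤ t k := fun k =>
    mul_nonneg zero_le_two (mul_nonneg hL (tailSum_nonneg k))
  -- Beyond `k₀` the total defect is below `1/2`, so at least half of the measure of `A k₀` survives
  -- all later steps.
  obtain ⟨k₀, hk₀⟩ : ∃ k₀, ∑' k, t (k + k₀) < 1 / 2 :=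
    ((tendsto_sum_nat_add t).eventually (gt_mem_nhds (by norm_num))).exists
  have hsum' : Summable fun k => t (k + k₀) := (summable_nat_add_iff k₀).2 hsum
  have hpart : ∀ n, ∑ i ∈ Finset.range n, t (i + k₀) ≤ 1 / 2 := fun n =>
    (hsum'.sum_le_tsum _ fun i _ => ht0 _).trans hk₀.le
  -- The elementary inequality `∏ (1 - t_i) ≥ 1 - ∑ t_i`, by induction.
  have hbound : ∀ n, (1 - ∑ i ∈ Finset.range n, t (i + k₀)) * μ.real (A k₀) ≤
      μ.real (A (n + k₀)) := by
    intro n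
    induction n with
    | zero => simp
    | succ n ih =>
      have h1 := hstep (n + k₀)
      have h2 : t (n + k₀) ≤ 1 / 2 :=
        (hsum'.le_tsum n fun i _ => ht0 _).trans hk₀.le
      have h3 : 0 ≤ ∑ i ∈ Finset.range n, t (i + k₀) := Finset.sum_nonneg fun i _ => ht0 _
      have h4 := mul_le_mul_of_nonneg_left ih (by linarith : (0 : ℝ) ≤ 1 - t (n + k₀))
      have h5 : 0 ≤ t (n + k₀) * (∑ i ∈ Finset.range n, t (i + k₀)) * μ.real (A k₀) :=
        mul_nonneg (mul_nonneg (ht0 _) h3) measureReal_nonneg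
      rw [Finset.sum_range_succ, show n + 1 + k₀ = n + k₀ + 1 by ring]
      have h6 : (1 - t (n + k₀)) * μ.real (A (n + k₀)) ≤ μ.real (A (n + k₀ + 1)) := h1
      nlinarith
  have hlower : ∀ k, μ.real (A k₀) / 2 ≤ μ.real (A k) := by
    intro k
    have h1 := hbound k
    have h2 : A (k + k₀) ⊆ A k := fun z hz j hj => hz j (by omega)
    have h3 := measureReal_mono h2 (μ := μ) (by finiteness)
    have h4 := hpart k
    have h5 : 0 ≤ μ.real (A k₀) := measureReal_nonneg
    nlinarith
  have hI : {z : (ℤ → I) × (ℤ → EuclideanSpace ℝ (Fin d)) | Regenerates F a γ L 0 z.1 z.2} =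
      ⋂ k, A k := by
    ext z
    simp only [Set.mem_iInter]
    exact ⟨fun h k j _ => h j, fun h k => h (k + 1) k k.lt_succ_self⟩
  have hlim : Filter.Tendsto (fun k => μ (A k)) Filter.atTop (nhds (μ (⋂ k, A k))) :=
    tendsto_measure_iInter_atTop (fun k => (hAm k).nullMeasurableSet)
      (fun k l hkl z hz j hj => hz j (by omega)) ⟨0, measure_ne_top _ _⟩
  rw [hI]
  have hhalf : 0 < ENNReal.ofReal (μ.real (A k₀) / 2) := by
    rw [ENNReal.ofReal_pos]
    exact half_pos (ENNReal.toReal_pos (hApos k₀).ne' (measure_ne_top _ _))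
  refine hhalf.trans_le (ge_of_tendsto' hlim fun k => ?_)
  rw [ENNReal.ofReal_le_iff_le_toReal (measure_ne_top _ _)]
  exact hlower k

/-- By stationarity each time regenerates with the same positive probability, so the limsup event
has positive probability; it is shift-invariant, and ergodicity makes it almost sure. -/
theorem ae_recurrent (hν : Ergodic seqShift ν) :
    ∀ᵐ z ∂((noiseLaw (volume : Measure I)).prod ν), Recurrent F a γ L z.1 z.2 := by
  set μ := (noiseLaw (volume : Measure I)).prod ν
  have hT : Ergodic (Prod.map seqShift seqShift) μ := ergodic_prodMap_seqShift volume hν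
  set R : ℕ → Set ((ℤ → I) × (ℤ → EuclideanSpace ℝ (Fin d))) := fun n =>
    {z | Regenerates F a γ L (-(n : ℤ)) z.1 z.2} with hR
  have hRm : ∀ n, MeasurableSet (R n) := fun n =>
    measurableSet_regenerates hF measurable_fst measurable_snd _
  have hRT : ∀ n, Prod.map seqShift seqShift ⁻¹' R (n + 1) = R n := by
    intro n
    ext z
    simp only [hR, Set.mem_preimage, Set.mem_ofPred_eq, Prod.map_fst, Prod.map_snd,
      regenerates_seqShift]
    rw [show (-((n + 1 : ℕ) : ℤ) + 1) = -(n : ℤ) by push_cast; ring]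
  have hRμ : ∀ n, μ (R n) = μ (R 0) := by
    intro n
    induction n with
    | zero => rfl
    | succ n ih =>
      rw [← ih, ← hRT n, hT.toMeasurePreserving.measure_preimage (hRm _).nullMeasurableSet]
  set H : Set ((ℤ → I) × (ℤ → EuclideanSpace ℝ (Fin d))) :=
    {z | Recurrent F a γ L z.1 z.2} with hH
  have hHeq : H = ⋂ N : ℕ, ⋃ n ≥ N, R n := by
    ext z
    simp only [hH, Recurrent, Filter.frequently_atTop, Set.mem_ofPred_eq, Set.mem_iInter,
      Set.mem_iUnion, hR, exists_prop]
  have hUm : ∀ N : ℕ, MeasurableSet (⋃ n ≥ N, R n) := fun N =>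
    MeasurableSet.iUnion fun n => MeasurableSet.iUnion fun _ => hRm n
  have hHm : MeasurableSet H := hHeq ▸ MeasurableSet.iInter hUm
  have hHT : Prod.map seqShift seqShift ⁻¹' H = H := by
    ext z
    have hz : ∀ n, Prod.map seqShift seqShift z ∈ R (n + 1) ↔ z ∈ R n := fun n => by
      rw [← Set.mem_preimage, hRT]
    have h1 : Prod.map seqShift seqShift z ∈ H ↔
        ∃ᶠ n in Filter.atTop, Prod.map seqShift seqShift z ∈ R n := Iff.rfl
    have h2 : z ∈ H ↔ ∃ᶠ n in Filter.atTop, z ∈ R n := Iff.rfl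
    rw [Set.mem_preimage, h1, h2]
    simp only [← hz]
    -- The shift moves the regeneration index by one, which does not affect occurring infinitely
    -- often.
    rw [← Filter.frequently_map (m := fun n => n + 1)
      (P := fun n => Prod.map seqShift seqShift z ∈ R n), Filter.map_add_atTop_eq_nat]
  have hlim : Filter.Tendsto (fun N : ℕ => μ (⋃ n ≥ N, R n)) Filter.atTop (nhds (μ H)) := by
    rw [hHeq]
    refine tendsto_measure_iInter_atTop (fun N => (hUm N).nullMeasurableSet)
      (fun N M hNM => ?_) ⟨0, measure_ne_top _ _⟩
    exact Set.biUnion_subset_biUnion_left fun n hn => hNM.trans hn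
  have hpos' : 0 < μ H := by
    refine (measure_regenerates_zero_pos (γ := γ) ν hF hpos hF1 hL ha).trans_le
      (ge_of_tendsto' hlim fun N => ?_)
    have h0 : μ (R 0) = μ {z | Regenerates F a γ L 0 z.1 z.2} := by simp [hR]
    rw [← h0, ← hRμ N]
    exact measure_mono (Set.subset_biUnion_of_mem (u := R) (le_refl N))
  have hone : μ H = 1 :=
    (hT.toPreErgodic.prob_eq_zero_or_one hHm hHT).resolve_left hpos'.ne'
  exact (prob_compl_eq_zero_iff hHm).2 hone

end Recurrence

/-! ### The model as a one-step evolution of the law of the history. -/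

section History

variable {α : Type*} [MeasurableSpace α] {d : ℕ}

/-- The path `y` with the values from time `t` on erased. -/
def pastTrunc (t : ℤ) (y : ℤ → Fin 2) : ℤ → Fin 2 := fun r => if r < t then y r else 0

/-- The history of the response before time `t`, together with the whole covariate path. -/
def history (t : ℤ) (y : α → ℤ → Fin 2) (x : α → ℤ → EuclideanSpace ℝ (Fin d)) (w : α) :
    (ℤ → Fin 2) × (ℤ → EuclideanSpace ℝ (Fin d)) :=
  (pastTrunc t (y w), x w)

/-- The conditional probability of a response `1` at time `t`, given the history, is `F(μ_t)`. -/
def FollowsModelAt (F : ℝ → ℝ) (a : ℕ+ → ℝ) (γ : EuclideanSpace ℝ (Fin d)) (P : Measure α)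
    (y : α → ℤ → Fin 2) (x : α → ℤ → EuclideanSpace ℝ (Fin d)) (t : ℤ) : Prop :=
  ∀ C, MeasurableSet C → P (history t y x ⁻¹' C ∩ {w | y w t = 1}) =
    ∫⁻ p in C, ENNReal.ofReal (F (score a γ p.1 p.2 t)) ∂(P.map (history t y x))

lemma pastTrunc_of_lt {t r : ℤ} (h : r < t) (y : ℤ → Fin 2) : pastTrunc t y r = y r := if_pos h

lemma measurable_pastTrunc (t : ℤ) : Measurable (pastTrunc t) := by
  refine measurable_pi_lambda _ fun r => ?_
  unfold pastTrunc
  split_ifs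
  · exact measurable_pi_apply r
  · exact measurable_const

lemma pastTrunc_succ (t : ℤ) (y : ℤ → Fin 2) :
    pastTrunc (t + 1) y = Function.update (pastTrunc t y) t (y t) := by
  ext1 r
  by_cases h : r = t
  · subst h
    rw [Function.update_self, pastTrunc_of_lt (by omega)]
  · rw [Function.update_of_ne h]
    unfold pastTrunc
    exact if_congr (by omega) rfl rfl

variable {F : ℝ → ℝ} {a : ℕ+ → ℝ} {γ : EuclideanSpace ℝ (Fin d)}
  {y : α → ℤ → Fin 2} {x : α → ℤ → EuclideanSpace ℝ (Fin d)}

lemma measurable_history (hy : Measurable y) (hx : Measurable x) (t : ℤ) :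
    Measurable (history t y x) :=
  ((measurable_pastTrunc t).comp hy).prodMk hx

lemma score_pastTrunc (t : ℤ) (y : ℤ → Fin 2) (x : ℤ → EuclideanSpace ℝ (Fin d)) :
    score a γ (pastTrunc t y) x t = score a γ y x t :=
  score_congr fun _ hr => pastTrunc_of_lt hr y

lemma measurable_ofReal_score (hF : Measurable F) (t : ℤ) :
    Measurable fun p : (ℤ → Fin 2) × (ℤ → EuclideanSpace ℝ (Fin d)) =>
      ENNReal.ofReal (F (score a γ p.1 p.2 t)) :=
  (hF.comp (measurable_score measurable_fst measurable_snd t)).ennreal_ofReal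

/-- The histories whose extension by the value `e` at time `t` belongs to `B`. -/
def extensionSet (t : ℤ) (e : Fin 2) (B : Set ((ℤ → Fin 2) × (ℤ → EuclideanSpace ℝ (Fin d)))) :
    Set ((ℤ → Fin 2) × (ℤ → EuclideanSpace ℝ (Fin d))) :=
  {p | (Function.update p.1 t e, p.2) ∈ B}

lemma measurableSet_extensionSet (t : ℤ) (e : Fin 2)
    {B : Set ((ℤ → Fin 2) × (ℤ → EuclideanSpace ℝ (Fin d)))} (hB : MeasurableSet B) :
    MeasurableSet (extensionSet t e B) :=
  ((measurable_fst.update_coord measurable_const t).prodMk measurable_snd) hB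

/-- The evolution of the law of the history over one time step. -/
lemma FollowsModelAt.map_history_succ {P : Measure α} [IsFiniteMeasure P] {t : ℤ}
    (h : FollowsModelAt F a γ P y x t) (hy : Measurable y) (hx : Measurable x)
    {B : Set ((ℤ → Fin 2) × (ℤ → EuclideanSpace ℝ (Fin d)))} (hB : MeasurableSet B) :
    P.map (history (t + 1) y x) B +
      ∫⁻ p in extensionSet t 0 B, ENNReal.ofReal (F (score a γ p.1 p.2 t))
        ∂(P.map (history t y x)) =
      ∫⁻ p in extensionSet t 1 B, ENNReal.ofReal (F (score a γ p.1 p.2 t))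
        ∂(P.map (history t y x)) + P.map (history t y x) (extensionSet t 0 B) := by
  have h0 := measurableSet_extensionSet t 0 hB
  have h1 := measurableSet_extensionSet t 1 hB
  have hm1 : MeasurableSet {w | y w t = 1} :=
    measurable_pi_iff.1 hy t (measurableSet_singleton (1 : Fin 2))
  rw [← h _ h0, ← h _ h1, Measure.map_apply (measurable_history hy hx _) hB,
    Measure.map_apply (measurable_history hy hx _) h0,
    ← measure_inter_add_sdiff (history (t + 1) y x ⁻¹' B) hm1,
    ← measure_inter_add_sdiff (history t y x ⁻¹' extensionSet t 0 B) hm1]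
  -- Once the response at `t` is known, the history at `t + 1` is an extension of the one at `t`.
  -- The identity is stated additively to avoid subtraction in `ENNReal`.
  have e1 : history (t + 1) y x ⁻¹' B ∩ {w | y w t = 1} =
      history t y x ⁻¹' extensionSet t 1 B ∩ {w | y w t = 1} := by
    ext w
    simp only [history, extensionSet, Set.mem_inter_iff, Set.mem_preimage, Set.mem_ofPred_eq,
      pastTrunc_succ]
    refine and_congr_left fun hw => ?_
    rw [hw]
  have e0 : history (t + 1) y x ⁻¹' B \ {w | y w t = 1} =
      history t y x ⁻¹' extensionSet t 0 B \ {w | y w t = 1} := by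
    ext w
    simp only [history, extensionSet, Set.mem_sdiff, Set.mem_preimage, Set.mem_ofPred_eq,
      pastTrunc_succ]
    refine and_congr_left fun hw => ?_
    have : y w t = 0 := by omega
    rw [this]
  rw [e1, e0]
  ring

lemma map_history_succ_congr {β : Type*} [MeasurableSpace β] {P : Measure α} {P' : Measure β}
    [IsFiniteMeasure P] [IsFiniteMeasure P'] (hF1 : ∀ p, F p ≤ 1)
    {y' : β → ℤ → Fin 2} {x' : β → ℤ → EuclideanSpace ℝ (Fin d)} {t : ℤ}
    (hy : Measurable y) (hx : Measurable x) (hy' : Measurable y') (hx' : Measurable x')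
    (h : FollowsModelAt F a γ P y x t) (h' : FollowsModelAt F a γ P' y' x' t)
    (heq : P.map (history t y x) = P'.map (history t y' x')) :
    P.map (history (t + 1) y x) = P'.map (history (t + 1) y' x') := by
  ext B hB
  have e := h.map_history_succ hy hx hB
  have e' := h'.map_history_succ hy' hx' hB
  rw [← heq, ← e] at e'
  refine ((ENNReal.add_left_inj ?_).1 e').symm
  refine ((setLIntegral_mono measurable_const (g := fun _ => 1) fun p _ => ?_).trans_lt ?_).ne
  · exact ENNReal.ofReal_le_one.2 (hF1 _)
  · rw [setLIntegral_one]
    exact measure_lt_top _ _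

omit [MeasurableSpace α] in
-- Conditioning thus becomes a statement about the law of a single random element, comparable
-- between different probability spaces.
lemma pastSigma_eq_comap (Y : ℤ → α → Fin 2) (X : ℤ → α → EuclideanSpace ℝ (Fin d)) (t : ℤ) :
    pastSigma Y X t = MeasurableSpace.comap
      (history t (fun w s => Y s w) (fun w s => X s w)) inferInstance := by
  apply le_antisymm
  · refine sup_le (iSup_le fun j => ?_) (iSup_le fun s => ?_)
    · rw [← measurable_iff_comap_le]
      have hc := comap_measurable (m := inferInstance)
        (history t (fun w s => Y s w) (fun w s => X s w))
      have := ((measurable_pi_apply (t - (j : ℤ))).comp measurable_fst).comp hc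
      convert! this using 1
      ext1 w
      exact (pastTrunc_of_lt (by have := j.pos; omega) fun s => Y s w).symm
    · rw [← measurable_iff_comap_le]
      exact ((measurable_pi_apply s).comp measurable_snd).comp
        (comap_measurable (history t (fun w s => Y s w) (fun w s => X s w)))
  · rw [← measurable_iff_comap_le]
    refine Measurable.prodMk (m := pastSigma Y X t)
      (f := fun w => pastTrunc t fun s => Y s w) (g := fun w s => X s w) ?_ ?_
    · refine @measurable_pi_lambda _ _ _ (pastSigma Y X t) _ _ fun r => ?_
      by_cases hr : r < t
      · simp only [pastTrunc_of_lt hr]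
        rw [measurable_iff_comap_le]
        obtain ⟨j, rfl⟩ : ∃ j : ℕ+, r = t - (j : ℤ) := by
          refine ⟨((t - r).toNat - 1).succPNat, ?_⟩
          rw [Nat.succPNat_coe]
          omega
        exact le_sup_of_le_left
          (le_iSup (fun j : ℕ+ => MeasurableSpace.comap (Y (t - (j : ℤ))) inferInstance) j)
      · simp only [pastTrunc, if_neg hr]
        exact measurable_const
    · refine @measurable_pi_lambda _ _ _ (pastSigma Y X t) _ _ fun s => ?_
      rw [measurable_iff_comap_le]
      exact le_sup_of_le_right (le_iSup (fun s => MeasurableSpace.comap (X s) inferInstance) s)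

lemma setLIntegral_history (P : Measure α) (hF : Measurable F) (hy : Measurable y)
    (hx : Measurable x) (t : ℤ) {C : Set ((ℤ → Fin 2) × (ℤ → EuclideanSpace ℝ (Fin d)))}
    (hC : MeasurableSet C) :
    ∫⁻ p in C, ENNReal.ofReal (F (score a γ p.1 p.2 t)) ∂(P.map (history t y x)) =
      ∫⁻ w in history t y x ⁻¹' C, ENNReal.ofReal (F (score a γ (y w) (x w) t)) ∂P := by
  rw [setLIntegral_map hC (measurable_ofReal_score hF t) (measurable_history hy hx t)]
  simp only [history, score_pastTrunc]

/-- The defining property of conditional expectation, tested on preimages under `history`.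
Uniqueness uses one direction, existence the other. -/
lemma condProb_eq_iff_followsModelAt {P : Measure α} [IsProbabilityMeasure P]
    (hF : Measurable F) (hpos : ∀ p, 0 < F p) (hF1 : ∀ p, F p ≤ 1)
    {Y : ℤ → α → Fin 2} {X : ℤ → α → EuclideanSpace ℝ (Fin d)} (hY : ∀ t, Measurable (Y t))
    (hX : ∀ t, Measurable (X t)) (t : ℤ) :
    (P⟦{w | Y t w = 1} | pastSigma Y X t⟧ =ᵐ[P] fun w => F (latent a γ Y X t w)) ↔
      FollowsModelAt F a γ P (fun w s => Y s w) (fun w s => X s w) t := by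
  have hy : Measurable fun w s => Y s w := measurable_pi_lambda _ hY
  have hx : Measurable fun w s => X s w := measurable_pi_lambda _ hX
  have hh := measurable_history hy hx t
  have hm1 : MeasurableSet {w | Y t w = 1} := hY t (measurableSet_singleton (1 : Fin 2))
  have hle : pastSigma Y X t ≤ (inferInstance : MeasurableSpace α) := by
    rw [pastSigma_eq_comap]
    exact hh.comap_le
  have hlat : (fun w => F (latent a γ Y X t w)) =
      (fun p => F (score a γ p.1 p.2 t)) ∘ history t (fun w s => Y s w) (fun w s => X s w) := by
    ext w
    simp only [Function.comp, history, score_pastTrunc]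
    rfl
  have hφ : Measurable fun p : (ℤ → Fin 2) × (ℤ → EuclideanSpace ℝ (Fin d)) =>
      F (score a γ p.1 p.2 t) := hF.comp (measurable_score measurable_fst measurable_snd t)
  have hlatm : Measurable fun w => F (latent a γ Y X t w) := hlat ▸ hφ.comp hh
  have hint : Integrable (fun w => F (latent a γ Y X t w)) P :=
    Integrable.of_bound hlatm.aestronglyMeasurable 1 (Filter.Eventually.of_forall fun w => by
      rw [Real.norm_of_nonneg (hpos _).le]
      exact hF1 _)
  have hind : Integrable ({w | Y t w = 1}.indicator fun _ => (1 : ℝ)) P :=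
    (integrable_const 1).indicator hm1
  have hconv : ∀ s : Set α, MeasurableSet s →
      (∫ w in s, F (latent a γ Y X t w) ∂P = ∫ w in s, {w | Y t w = 1}.indicator 1 w ∂P ↔
        P (s ∩ {w | Y t w = 1}) = ∫⁻ w in s, ENNReal.ofReal (F (latent a γ Y X t w)) ∂P) := by
    intro s hs
    rw [integral_indicator_one hm1, measureReal_restrict_apply hm1, Set.inter_comm,
      ← ofReal_integral_eq_lintegral_ofReal hint.integrableOn
        (Filter.Eventually.of_forall fun w => (hpos _).le), Measure.real,
      ← ENNReal.toReal_eq_toReal_iff' (measure_ne_top _ _) ENNReal.ofReal_ne_top,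
      ENNReal.toReal_ofReal (integral_nonneg fun w => (hpos _).le), eq_comm]
  constructor
  · intro h C hC
    have hs : MeasurableSet[pastSigma Y X t]
        (history t (fun w s => Y s w) (fun w s => X s w) ⁻¹' C) := by
      rw [pastSigma_eq_comap]
      exact ⟨C, hC, rfl⟩
    rw [setLIntegral_history P hF hy hx t hC]
    refine (hconv _ (hle _ hs)).1 ?_
    refine Eq.trans ?_ (setIntegral_condExp hle hind hs)
    exact (setIntegral_congr_ae (hle _ hs) (h.mono fun w hw _ => hw)).symm
  · intro h
    refine (ae_eq_condExp_of_forall_setIntegral_eq hle hind (fun s _ _ => hint.integrableOn)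
      (fun s hs _ => ?_) ?_).symm
    · refine (hconv s (hle _ hs)).2 ?_
      rw [pastSigma_eq_comap] at hs
      obtain ⟨C, hC, rfl⟩ := hs
      have := h C hC
      rw [setLIntegral_history P hF hy hx t hC] at this
      exact this
    · rw [hlat, pastSigma_eq_comap]
      exact (hφ.comp (comap_measurable _)).stronglyMeasurable.aestronglyMeasurable

/-- A process that follows the recursion at time `t` with noise that is independent of the
history satisfies the model at time `t`. -/
lemma followsModelAt_of_response {S : Type*} [MeasurableSpace S] (ν : Measure S)
    [IsProbabilityMeasure ν] (hF : Measurable F) (hpos : ∀ p, 0 < F p) (hF1 : ∀ p, F p ≤ 1)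
    {y : (ℤ → I) × S → ℤ → Fin 2} {x : S → ℤ → EuclideanSpace ℝ (Fin d)} {t : ℤ}
    (hy : Measurable y) (hx : Measurable x)
    (hpast : ∀ z v, ∀ r < t, y (Function.update z.1 t v, z.2) r = y z r)
    (hrec : ∀ᵐ z ∂((noiseLaw (volume : Measure I)).prod ν),
      y z t = response F a γ (y z) (x z.2) t (z.1 t)) :
    FollowsModelAt F a γ ((noiseLaw (volume : Measure I)).prod ν) y (fun z => x z.2) t := by
  intro C hC
  have hx' : Measurable fun z : (ℤ → I) × S => x z.2 := hx.comp measurable_snd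
  rw [setLIntegral_history _ hF hy hx' t hC]
  set D : Set (((ℤ → I) × S) × I) := {p | (p.2 : ℝ) ≤ F (score a γ (y p.1) (x p.1.2) t)}
  have hD : MeasurableSet D := measurableSet_le (measurable_subtype_coe.comp measurable_snd)
    (hF.comp (measurable_score (hy.comp measurable_fst) (hx'.comp measurable_fst) t))
  have hhist : ∀ z v, history t y (fun z => x z.2) (Function.update z.1 t v, z.2) =
      history t y (fun z => x z.2) z := by
    intro z v
    simp only [history, Prod.mk.injEq, and_true]
    ext1 r
    unfold pastTrunc
    split_ifs with hr
    · exact hpast z v r hr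
    · rfl
  have hset : (history t y (fun z => x z.2) ⁻¹' C ∩ {z | y z t = 1} : Set ((ℤ → I) × S))
      =ᵐ[(noiseLaw (volume : Measure I)).prod ν]
      (history t y (fun z => x z.2) ⁻¹' C ∩ {z | (z, z.1 t) ∈ D} : Set ((ℤ → I) × S)) := by
    refine Filter.EventuallyEq.inter (Filter.EventuallyEq.refl _ _) ?_
    filter_upwards [hrec] with z hz
    have : (y z t = 1) = ((z.1 t : ℝ) ≤ F (score a γ (y z) (x z.2) t)) := by
      rw [hz, eq_iff_iff]
      unfold response
      split_ifs with h <;> simp [h]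
    exact this
  rw [measure_congr hset, measure_inter_coord_mem volume ν t (measurable_history hy hx' t hC) hD]
  · refine lintegral_congr fun z => ?_
    exact volume_unitInterval_le (hpos (score a γ (y z) (x z.2) t)).le (hF1 _)
  · intro z v
    rw [Set.mem_preimage, hhist, Set.mem_preimage]
  · intro z v w
    simp only [D, Set.mem_ofPred_eq]
    rw [score_congr (hpast z v)]

end History

/-! ### Every solution has the law of the limit path. -/

section Uniqueness

variable {d : ℕ} {F : ℝ → ℝ} {a : ℕ+ → ℝ} {γ : EuclideanSpace ℝ (Fin d)} {L : ℝ}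

/-- The bivariate path built from the noise and the covariate path. -/
noncomputable def solution (F : ℝ → ℝ) (a : ℕ+ → ℝ) (γ : EuclideanSpace ℝ (Fin d))
    (z : (ℤ → I) × (ℤ → EuclideanSpace ℝ (Fin d))) (t : ℤ) : Fin 2 × EuclideanSpace ℝ (Fin d) :=
  (limitPath F a γ z.1 z.2 t, z.2 t)

lemma measurable_zip {α E G : Type*} [MeasurableSpace α] [MeasurableSpace E] [MeasurableSpace G]
    {y : α → ℤ → E} {x : α → ℤ → G} (hy : Measurable y) (hx : Measurable x) :
    Measurable fun w t => (y w t, x w t) :=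
  measurable_pi_lambda _ fun t => (measurable_pi_iff.1 hy t).prodMk (measurable_pi_iff.1 hx t)

lemma measurable_solution (hF : Measurable F) : Measurable (solution F a γ) :=
  measurable_zip (measurable_limitPath hF measurable_fst measurable_snd) measurable_snd

variable {β : Type*} [MeasurableSpace β] {P : Measure β} [IsProbabilityMeasure P]
  {y : β → ℤ → Fin 2} {x : β → ℤ → EuclideanSpace ℝ (Fin d)}

/-- A solution of the model has the same law as the process that is driven by independent noise
from time `s` on. -/
lemma map_history_eq_map_path (hF : Measurable F) (hpos : ∀ p, 0 < F p) (hF1 : ∀ p, F p ≤ 1)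
    (hy : Measurable y) (hx : Measurable x) (h : ∀ t, FollowsModelAt F a γ P y x t) (s : ℤ)
    (k : ℕ) :
    P.map (history (s + k) y x) = ((noiseLaw (volume : Measure I)).prod P).map
      (history (s + k) (fun z => path F a γ s (y z.2) z.1 (x z.2)) fun z => x z.2) := by
  have hpm : Measurable fun z : (ℤ → I) × β => path F a γ s (y z.2) z.1 (x z.2) :=
    measurable_path hF s (hy.comp measurable_snd) measurable_fst (hx.comp measurable_snd)
  have hxm : Measurable fun z : (ℤ → I) × β => x z.2 := hx.comp measurable_snd
  induction k with
  | zero =>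
    have e : history (s + (0 : ℕ)) (fun z : (ℤ → I) × β => path F a γ s (y z.2) z.1 (x z.2))
        (fun z => x z.2) = history (s + (0 : ℕ)) y x ∘ Prod.snd := by
      ext1 z
      simp only [history, Function.comp, Prod.mk.injEq, and_true]
      ext1 r
      unfold pastTrunc
      refine ite_congr rfl (fun hr => path_of_lt (by simpa using hr)) fun _ => rfl
    rw [e, ← Measure.map_map (measurable_history hy hx _) measurable_snd, Measure.map_snd_prod,
      measure_univ, one_smul]
  | succ k ih =>
    push_cast
    rw [← add_assoc]
    refine map_history_succ_congr hF1 hy hx hpm hxm (h _) ?_ ih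
    refine followsModelAt_of_response P hF hpos hF1 hpm hx (fun z v r hr => ?_)
      (Filter.Eventually.of_forall fun z => path_solvesFrom s _ (by omega))
    exact path_congr_noise fun q hq => Function.update_of_ne (by omega) _ _

variable (hmono : Monotone F) (hlip : ∀ p q, |F p - F q| ≤ L * |p - q|) (hL : 0 ≤ L)
  (ha : Summable fun j => |a j|) (hF : Measurable F) (hpos : ∀ p, 0 < F p) (hF1 : ∀ p, F p ≤ 1)

include hmono hlip hL ha hF hpos hF1

theorem map_zip_eq_map_solution (hy : Measurable y) (hx : Measurable x)
    (h : ∀ t, FollowsModelAt F a γ P y x t)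
    (hrec : ∀ᵐ z ∂((noiseLaw (volume : Measure I)).prod P), Recurrent F a γ L z.1 (x z.2)) :
    P.map (fun w t => (y w t, x w t)) =
      ((noiseLaw (volume : Measure I)).prod P).map fun z => solution F a γ (z.1, x z.2) := by
  set m := (noiseLaw (volume : Measure I)).prod P
  have hxm : Measurable fun z : (ℤ → I) × β => x z.2 := hx.comp measurable_snd
  have hsol : Measurable fun z : (ℤ → I) × β => solution F a γ (z.1, x z.2) :=
    (measurable_solution hF).comp (measurable_fst.prodMk hxm)
  have hzip := measurable_zip hy hx
  have := Measure.isProbabilityMeasure_map (μ := m) hsol.aemeasurable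
  -- Laws on the path space are determined by finite windows; `c` bounds the window `J` on both
  -- sides.
  have hwin : ∀ J : Finset ℤ, (P.map fun w t => (y w t, x w t)).map J.restrict =
      (m.map fun z => solution F a γ (z.1, x z.2)).map J.restrict := by
    intro J
    have hJ := Finset.measurable_restrict (X := fun _ : ℤ => Fin 2 × EuclideanSpace ℝ (Fin d)) J
    rw [Measure.map_map hJ hzip, Measure.map_map hJ hsol]
    ext B hB
    rw [Measure.map_apply (hJ.comp hzip) hB, Measure.map_apply (hJ.comp hsol) hB]
    obtain ⟨c, hc⟩ : ∃ c : ℕ, ∀ t ∈ J, -(c : ℤ) ≤ t ∧ t < c := by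
      obtain ⟨b, hb⟩ := J.bddAbove
      obtain ⟨l, hl⟩ := J.bddBelow
      refine ⟨b.toNat + (-l).toNat + 1, fun t ht => ?_⟩
      have h1 := hb ht
      have h2 := hl ht
      omega
    set Y : ℕ → (ℤ → I) × β → ℤ → Fin 2 := fun n z =>
      path F a γ (-((c + n : ℕ) : ℤ)) (y z.2) z.1 (x z.2)
    have hYm : ∀ n, Measurable (Y n) := fun n =>
      measurable_path hF _ (hy.comp measurable_snd) measurable_fst hxm
    -- A regeneration occurs after the starting time `-(c + n)` of `Y n` (or at it) and no later
    -- than `-c`, hence before the window. These events increase to a set of full measure.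
    set G : ℕ → Set ((ℤ → I) × β) := fun n =>
      {z | ∃ i ≤ n, Regenerates F a γ L (-((c + i : ℕ) : ℤ)) z.1 (x z.2)} with hGdef
    have hGm : ∀ n, MeasurableSet (G n) := by
      intro n
      simp only [hGdef, Set.ofPred_exists, Set.ofPred_and]
      exact MeasurableSet.iUnion fun i => MeasurableSet.inter (MeasurableSet.const _)
        (measurableSet_regenerates hF measurable_fst hxm _)
    have hGlim : Filter.Tendsto (fun n => m (G n)ᶜ) Filter.atTop (nhds 0) := by
      have h0 : m (⋂ n, (G n)ᶜ) = 0 := by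
        refine measure_mono_null (fun z hz => ?_) (ae_iff.1 hrec)
        intro hz'
        obtain ⟨n, hn, hr⟩ := Filter.frequently_atTop.1 hz' c
        have := Set.mem_iInter.1 hz (n - c)
        refine this ⟨n - c, le_rfl, ?_⟩
        rwa [Nat.add_sub_cancel' hn]
      rw [← h0]
      refine tendsto_measure_iInter_atTop (fun n => (hGm n).compl.nullMeasurableSet)
        (fun n k hnk => Set.compl_subset_compl.2 ?_) ⟨0, measure_ne_top _ _⟩
      rintro z ⟨i, hi, hr⟩
      exact ⟨i, hi.trans hnk, hr⟩
    set U : (ℤ → Fin 2) × (ℤ → EuclideanSpace ℝ (Fin d)) → (J → Fin 2 × EuclideanSpace ℝ (Fin d)) :=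
      fun p j => (p.1 j, p.2 j) with hUdef
    have hUm : Measurable U := measurable_pi_lambda _ fun j =>
      ((measurable_pi_apply _).comp measurable_fst).prodMk
        ((measurable_pi_apply _).comp measurable_snd)
    have hUhist : ∀ {δ : Type _} (y' : δ → ℤ → Fin 2) (x' : δ → ℤ → EuclideanSpace ℝ (Fin d)) w,
        U (history c y' x' w) = fun j : J => (y' w j, x' w j) := by
      intro δ y' x' w
      ext1 j
      simp only [hUdef, history, pastTrunc_of_lt (hc j j.2).2]
    have hleft : ∀ n, P ((J.restrict ∘ fun w t => (y w t, x w t)) ⁻¹' B) =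
        m {z | (fun j : J => (Y n z j, x z.2 j)) ∈ B} := by
      intro n
      -- This number of steps leads from `-(c + n)` to `c`, beyond the window.
      have e := map_history_eq_map_path hF hpos hF1 hy hx h (-((c + n : ℕ) : ℤ)) (c + n + c)
      rw [show (-((c + n : ℕ) : ℤ) + ((c + n + c : ℕ) : ℤ)) = c by push_cast; ring] at e
      have e2 := DFunLike.congr_fun e (U ⁻¹' B)
      rw [Measure.map_apply (measurable_history hy hx _) (hUm hB),
        Measure.map_apply (measurable_history (hYm n) hxm _) (hUm hB)] at e2
      have e3 : history c y x ⁻¹' (U ⁻¹' B) =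
          (J.restrict ∘ fun w t => (y w t, x w t)) ⁻¹' B := by
        ext w
        rw [Set.mem_preimage, Set.mem_preimage, hUhist]
        rfl
      have e4 : history c (Y n) (fun z => x z.2) ⁻¹' (U ⁻¹' B) =
          {z | (fun j : J => (Y n z j, x z.2 j)) ∈ B} := by
        ext z
        rw [Set.mem_preimage, Set.mem_preimage, hUhist]
        rfl
      rw [← e3, ← e4]
      exact e2
    have hagree : ∀ n, ∀ z ∈ G n, ∀ j ∈ J, Y n z j = limitPath F a γ z.1 (x z.2) j := by
      rintro n z ⟨i, hi, hr⟩ j hj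
      have hle : -((c + i : ℕ) : ℤ) ≤ j := by have := (hc j hj).1; push_cast; omega
      rw [hr.limitPath_eq hmono hlip hL ha hle]
      exact hr.eq_path hmono hlip hL ha ((path_solvesFrom _).mono (by push_cast; omega)) hle
    have hiff : ∀ n, ∀ z ∈ G n, ((fun j : J => (Y n z j, x z.2 j)) ∈ B ↔
        z ∈ (J.restrict ∘ fun z => solution F a γ (z.1, x z.2)) ⁻¹' B) := by
      intro n z hz
      have : (fun j : J => (Y n z j, x z.2 j)) =
          (J.restrict ∘ fun z : (ℤ → I) × β => solution F a γ (z.1, x z.2)) z := by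
        ext1 j
        rw [hagree n z hz j j.2]
        rfl
      rw [this]
      rfl
    set b := m ((J.restrict ∘ fun z => solution F a γ (z.1, x z.2)) ⁻¹' B)
    have hlim : Filter.Tendsto (fun n => b + m (G n)ᶜ) Filter.atTop (nhds b) := by
      simpa using tendsto_const_nhds.add hGlim
    have hlim' : Filter.Tendsto
        (fun n => P ((J.restrict ∘ fun w t => (y w t, x w t)) ⁻¹' B) + m (G n)ᶜ) Filter.atTop
        (nhds (P ((J.restrict ∘ fun w t => (y w t, x w t)) ⁻¹' B))) := by
      simpa using tendsto_const_nhds.add hGlim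
    -- Coupling estimate: on `G n` the continued solution agrees with the limit path on `J`, so the
    -- two probabilities differ by at most `m (G n)ᶜ`.
    apply le_antisymm
    · refine ge_of_tendsto' hlim fun n => ?_
      rw [hleft n]
      refine (measure_mono fun z hz => ?_).trans (measure_union_le _ _)
      by_cases hG : z ∈ G n
      · exact Or.inl ((hiff n z hG).1 hz)
      · exact Or.inr hG
    · refine ge_of_tendsto' hlim' fun n => ?_
      rw [hleft n]
      refine (measure_mono fun z hz => ?_).trans (measure_union_le _ _)
      by_cases hG : z ∈ G n
      · exact Or.inl ((hiff n z hG).2 hz)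
      · exact Or.inr hG
  exact IsProjectiveLimit.unique
    (P := fun J : Finset ℤ => (m.map fun z : (ℤ → I) × β => solution F a γ (z.1, x z.2)).map
      J.restrict) hwin fun _ => rfl

theorem SatisfiesBinaryModel.pathLaw_eq {Y : ℤ → β → Fin 2}
    {X : ℤ → β → EuclideanSpace ℝ (Fin d)} (h : SatisfiesBinaryModel F a γ P Y X)
    (hrec : ∀ᵐ z ∂((noiseLaw (volume : Measure I)).prod (pathLaw P X)),
      Recurrent F a γ L z.1 z.2) :
    pathLaw P (jointProcess Y X) =
      ((noiseLaw (volume : Measure I)).prod (pathLaw P X)).map (solution F a γ) := by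
  have hx : Measurable fun w s => X s w := measurable_pi_lambda _ h.measurable_covariate
  have hxm : Measurable (Prod.map id (fun w s => X s w) : (ℤ → I) × β → _) :=
    measurable_id.prodMap hx
  have e : (noiseLaw (volume : Measure I)).prod (pathLaw P X) =
      ((noiseLaw (volume : Measure I)).prod P).map (Prod.map id fun w s => X s w) := by
    rw [← Measure.map_prod_map _ _ measurable_id hx, Measure.map_id]
    rfl
  rw [e] at hrec ⊢
  rw [Measure.map_map (measurable_solution hF) hxm]
  exact map_zip_eq_map_solution hmono hlip hL ha hF hpos hF1
    (measurable_pi_lambda _ h.measurable_response) hx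
    (fun t => (condProb_eq_iff_followsModelAt hF hpos hF1 h.measurable_response
      h.measurable_covariate t).1 (h.condProb_eq t)) (ae_of_ae_map hxm.aemeasurable hrec)

end Uniqueness

/-! ### Ergodicity of the limit path and the model equation for it. -/

section Existence

lemma Ergodic.map_of_ae_semiconj {α β : Type*} [MeasurableSpace α] [MeasurableSpace β]
    {μ : Measure α} {T : α → α} {S : β → β} {f : α → β} (hT : Ergodic T μ) (hf : Measurable f)
    (hS : Measurable S) (h : f ∘ T =ᵐ[μ] S ∘ f) : Ergodic S (μ.map f) := by
  have hmp : MeasurePreserving f μ (μ.map f) := ⟨hf, rfl⟩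
  refine ⟨⟨hS, ?_⟩, ⟨fun s hs hSs => ?_⟩⟩
  · rw [Measure.map_map hS hf, ← Measure.map_congr h, ← Measure.map_map hf hT.measurable,
      hT.map_eq]
  · rw [← hmp.aeconst_preimage hs.nullMeasurableSet]
    -- Since `f` intertwines the maps only almost everywhere, the preimage of an invariant set is
    -- invariant only up to a null set.
    refine hT.quasiErgodic.aeconst_set₀ (hf hs).nullMeasurableSet ?_
    filter_upwards [h] with z hz
    have hz' : f (T z) = S (f z) := hz
    have : (f (T z) ∈ s) = (f z ∈ s) := by
      rw [hz', ← Set.mem_preimage, hSs]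
    exact this

variable {d : ℕ} {F : ℝ → ℝ} {a : ℕ+ → ℝ} {γ : EuclideanSpace ℝ (Fin d)} {L : ℝ}
  (hmono : Monotone F) (hlip : ∀ p q, |F p - F q| ≤ L * |p - q|) (hL : 0 ≤ L)
  (ha : Summable fun j => |a j|) (hF : Measurable F)

include hmono hlip hL ha hF

theorem ergodic_map_solution {ν : Measure (ℤ → EuclideanSpace ℝ (Fin d))} [IsProbabilityMeasure ν]
    (hν : Ergodic seqShift ν) (hrec : ∀ᵐ z ∂((noiseLaw (volume : Measure I)).prod ν),
      Recurrent F a γ L z.1 z.2) :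
    Ergodic seqShift (((noiseLaw (volume : Measure I)).prod ν).map (solution F a γ)) := by
  have hT := ergodic_prodMap_seqShift (volume : Measure I) hν
  refine hT.map_of_ae_semiconj (measurable_solution hF) measurable_seqShift ?_
  filter_upwards [hrec, hT.quasiMeasurePreserving.ae hrec] with z hz hz'
  ext1 t
  have := congrFun (hz.limitPath_seqShift hmono hlip hL ha hz') t
  exact Prod.ext this rfl

/-- The process that is built from independent noise satisfies the model. -/
theorem satisfiesBinaryModel_map {Ω : Type*} [MeasurableSpace Ω] (P : Measure Ω)
    [IsProbabilityMeasure P] (hpos : ∀ p, 0 < F p) (hF1 : ∀ p, F p ≤ 1)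
    {X : ℤ → Ω → EuclideanSpace ℝ (Fin d)} (hX : ∀ t, Measurable (X t))
    (hrec : ∀ᵐ z ∂((noiseLaw (volume : Measure I)).prod P),
      Recurrent F a γ L z.1 fun s => X s z.2) :
    SatisfiesBinaryModel F a γ
      (((noiseLaw (volume : Measure I)).prod P).map fun z =>
        (limitPath F a γ z.1 fun s => X s z.2, z.2))
      coordResponse (liftCovariate X) := by
  have hx : Measurable fun w s => X s w := measurable_pi_lambda _ hX
  set m := (noiseLaw (volume : Measure I)).prod P
  set Θ : (ℤ → I) × Ω → (ℤ → Fin 2) × Ω := fun z => (limitPath F a γ z.1 fun s => X s z.2, z.2)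
  have hlm : Measurable fun z : (ℤ → I) × Ω => limitPath F a γ z.1 fun s => X s z.2 :=
    measurable_limitPath hF measurable_fst (hx.comp measurable_snd)
  have hΘ : Measurable Θ := hlm.prodMk measurable_snd
  have := Measure.isProbabilityMeasure_map (μ := m) hΘ.aemeasurable
  have hYm : ∀ t, Measurable (coordResponse t : (ℤ → Fin 2) × Ω → Fin 2) := fun t =>
    (measurable_pi_apply t).comp measurable_fst
  have hXm : ∀ t, Measurable (liftCovariate X t : (ℤ → Fin 2) × Ω → _) := fun t =>
    (hX t).comp measurable_snd
  refine ⟨hYm, hXm, fun t => (condProb_eq_iff_followsModelAt hF hpos hF1 hYm hXm t).2 ?_⟩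
  intro C hC
  have hh := measurable_history (measurable_pi_lambda _ hYm) (measurable_pi_lambda _ hXm) t
  have hmodel : FollowsModelAt F a γ m (fun z => limitPath F a γ z.1 fun s => X s z.2)
      (fun z s => X s z.2) t :=
    followsModelAt_of_response P hF hpos hF1 hlm hx
      (fun z v r hr => limitPath_congr_noise fun q hq => Function.update_of_ne (by omega) _ _)
      (hrec.mono fun z hz => hz.limitPath_eq_response hmono hlip hL ha t)
  have h := hmodel C hC
  rw [Measure.map_map hh hΘ, Measure.map_apply hΘ]
  · exact h
  · exact (hh hC).inter (hYm t (measurableSet_singleton (1 : Fin 2)))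

end Existence

/-! ### Assembly of existence, ergodicity and uniqueness. -/

theorem proposition1 {Ω : Type*} [MeasurableSpace Ω] (P : Measure Ω)
    [IsProbabilityMeasure P] {d : ℕ} (X : ℤ → Ω → EuclideanSpace ℝ (Fin d))
    (hX : IsStationaryErgodicProcess P X)
    (ρ : Measure ℝ) [IsProbabilityMeasure ρ] (F : ℝ → ℝ) (hF : ∀ x, F x = cdf ρ x)
    (hF_lip : ∃ L : NNReal, LipschitzWith L F) (hF_pos : ∀ x, 0 < F x)
    (a : ℕ+ → ℝ) (ha : Summable fun j : ℕ+ => ((j : ℕ) : ℝ) * |a j|)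
    (γ : EuclideanSpace ℝ (Fin d)) :
    ∃ Q : Measure ((ℤ → Fin 2) × Ω),
      IsProbabilityMeasure Q ∧
      -- `Q` enlarges the original probability space
      Q.map Prod.snd = P ∧
      -- existence of a stationary solution
      SatisfiesBinaryModel F a γ Q coordResponse (liftCovariate X) ∧
      IsStationaryProcess Q (coordResponse : ℤ → (ℤ → Fin 2) × Ω → Fin 2) ∧
      -- the bivariate process is stationary and ergodic
      IsStationaryErgodicProcess Q (jointProcess coordResponse (liftCovariate X)) ∧
      -- uniqueness in law, among all solutions on all probability spaces
      (∀ (Ω' : Type*) [MeasurableSpace Ω'] (P' : Measure Ω') [IsProbabilityMeasure P']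
        (Y' : ℤ → Ω' → Fin 2) (X' : ℤ → Ω' → EuclideanSpace ℝ (Fin d)),
        pathLaw P' X' = pathLaw P X →
        SatisfiesBinaryModel F a γ P' Y' X' →
        pathLaw P' (jointProcess Y' X') =
          pathLaw Q (jointProcess coordResponse (liftCovariate X))) := by
  obtain ⟨L, hLip⟩ := hF_lip
  have hmono : Monotone F := fun p q hpq => by
    rw [hF, hF]
    exact monotone_cdf ρ hpq
  have hF1 : ∀ p, F p ≤ 1 := fun p => by
    rw [hF]
    exact cdf_le_one ρ p
  have hFm : Measurable F := hLip.continuous.measurable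
  have hlip : ∀ p q, |F p - F q| ≤ (L : ℝ) * |p - q| := fun p q => hLip.dist_le_mul p q
  have hL : (0 : ℝ) ≤ L := L.2
  have ha' := summable_abs_of_moment ha
  have hXm := hX.measurable
  have hx : Measurable fun w s => X s w := measurable_pi_lambda _ hXm
  have : IsProbabilityMeasure (pathLaw P X) := Measure.isProbabilityMeasure_map hx.aemeasurable
  have hrec := ae_recurrent (γ := γ) (pathLaw P X) hFm hF_pos hF1 hL ha hX.ergodic
  have hrecΩ : ∀ᵐ z ∂((noiseLaw (volume : Measure I)).prod P),
      Recurrent F a γ L z.1 fun s => X s z.2 := by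
    have hm : Measurable (Prod.map id (fun w s => X s w) : (ℤ → I) × Ω → _) :=
      measurable_id.prodMap hx
    refine ae_of_ae_map hm.aemeasurable (p := fun z => Recurrent F a γ L z.1 z.2) ?_
    rw [← Measure.map_prod_map _ _ measurable_id hx, Measure.map_id]
    exact hrec
  have hlm : Measurable fun z : (ℤ → I) × Ω => limitPath F a γ z.1 fun s => X s z.2 :=
    measurable_limitPath hFm measurable_fst (hx.comp measurable_snd)
  have hΘ := hlm.prodMk (measurable_snd : Measurable (Prod.snd : (ℤ → I) × Ω → Ω))
  have hmodel := satisfiesBinaryModel_map hmono hlip hL ha' hFm P hF_pos hF1 hXm hrecΩ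
  set Q := ((noiseLaw (volume : Measure I)).prod P).map fun z =>
    (limitPath F a γ z.1 fun s => X s z.2, z.2)
  have hQ : IsProbabilityMeasure Q := Measure.isProbabilityMeasure_map hΘ.aemeasurable
  have hQsnd : Q.map Prod.snd = P := by
    rw [Measure.map_map measurable_snd hΘ]
    exact Measure.map_snd_prod.trans (by rw [measure_univ, one_smul])
  have hQX : pathLaw Q (liftCovariate X) = pathLaw P X := by
    conv_rhs => rw [← hQsnd]
    exact (Measure.map_map hx measurable_snd).symm
  -- The constructed process is itself a solution, so the formula behind uniqueness also computes
  -- its law.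
  have hQlaw : pathLaw Q (jointProcess coordResponse (liftCovariate X)) =
      ((noiseLaw (volume : Measure I)).prod (pathLaw P X)).map (solution F a γ) := by
    rw [hmodel.pathLaw_eq hmono hlip hL ha' hFm hF_pos hF1 (hQX ▸ hrec), hQX]
  have hjm : ∀ t, Measurable (jointProcess coordResponse (liftCovariate X) t :
      (ℤ → Fin 2) × Ω → _) := fun t =>
    (hmodel.measurable_response t).prodMk (hmodel.measurable_covariate t)
  have herg : Ergodic seqShift (pathLaw Q (jointProcess coordResponse (liftCovariate X))) := by
    rw [hQlaw]
    exact ergodic_map_solution hmono hlip hL ha' hFm hX.ergodic hrec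
  refine ⟨Q, hQ, hQsnd, hmodel, ⟨hmodel.measurable_response, ?_⟩,
    ⟨⟨hjm, herg.toMeasurePreserving⟩, herg⟩, ?_⟩
  -- Stationarity of the response alone is inherited through the coordinate projection, which
  -- commutes with the shift.
  · have hfst : Measurable fun (z : ℤ → Fin 2 × EuclideanSpace ℝ (Fin d)) t => (z t).1 :=
      measurable_pi_lambda _ fun t => measurable_fst.comp (measurable_pi_apply t)
    have hmp : MeasurePreserving (fun (z : ℤ → Fin 2 × EuclideanSpace ℝ (Fin d)) t => (z t).1)
        (pathLaw Q (jointProcess coordResponse (liftCovariate X)))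
        (pathLaw Q (coordResponse : ℤ → (ℤ → Fin 2) × Ω → Fin 2)) :=
      ⟨hfst, Measure.map_map hfst (measurable_pi_lambda _ hjm)⟩
    exact hmp.of_semiconj herg.toMeasurePreserving (fun _ => rfl) measurable_seqShift
  · intro Ω' _ P' _ Y' X' hX' h
    rw [hQlaw, h.pathLaw_eq hmono hlip hL ha' hFm hF_pos hF1 (hX' ▸ hrec), hX']
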